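/- For integers $a_1,a_2,a_3,b$ and a positive integer $n$, let $\mathrm{eq}(a_1,a_2,a_3,b)$ denote the equation $a_1x_1+a_2x_2+a_3x_3=b$. An exact $r$-coloring of $\mathbb{Z}_n$ is a surjective function $c:\mathbb{Z}_n\to\{1,\dots,r\}$; a rainbow solution for $c$ is a triple $(s_1,s_2,s_3)\in\mathbb{Z}_n^3$ with $a_1s_1+a_2s_2+a_3s_3\equiv b \pmod n$ such that $c(s_1),c(s_2),c(s_3)$ are pairwise distinct. Let $\mathrm{rb}(\mathbb{Z}_n,\mathrm{eq}(a_1,a_2,a_3,b))$ be the smallest positive integer $r$ such that every exact $r$-coloring of $\mathbb{Z}_n$ has a rainbow solution; for $r=n+1$ this holds vacuously, so the value is $n+1$ if no positive $r\le n$ has the property. Theorem. Let $n=p_1^{\alpha_1}p_2^{\alpha_2}\cdots p_\ell^{\alpha_\ell}$ with $p_k$ prime and $\alpha_k\ge 0$ for $1\le k\le\ell$, and let $a_1,a_2,a_3,b$ be integers such that both $a_1+a_2+a_3$ and $a_1a_2a_3$ are units modulo $n$. Then $$2+\sum_{k=1}^{\ell}\alpha_k\bigl(\mathrm{rb}(\mathbb{Z}_{p_k},\mathrm{eq}(a_1,a_2,a_3,b))-2\bigr)\le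 \mathrm{rb}(\mathbb{Z}_n,\mathrm{eq}(a_1,a_2,a_3,b)).$$ -/

import Mathlib

/-- `(s₁, s₂, s₃)` is a solution in `ℤ/nℤ` of `a₁ x₁ + a₂ x₂ + a₃ x₃ = b`. -/
def IsSolution (n : ℕ) (a₁ a₂ a₃ b : ℤ) (s₁ s₂ s₃ : ZMod n) : Prop :=
  (a₁ : ZMod n) * s₁ + (a₂ : ZMod n) * s₂ + (a₃ : ZMod n) * s₃ = (b : ZMod n)

/-- The coloring `c` of `ℤ/nℤ` has a rainbow solution: one whose three entries receive three
pairwise distinct colors. -/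
def HasRainbowSolution (n : ℕ) (a₁ a₂ a₃ b : ℤ) {r : ℕ} (c : ZMod n → Fin r) : Prop :=
  ∃ s₁ s₂ s₃ : ZMod n, IsSolution n a₁ a₂ a₃ b s₁ s₂ s₃ ∧
    c s₁ ≠ c s₂ ∧ c s₁ ≠ c s₃ ∧ c s₂ ≠ c s₃

/-- Every exact (that is, surjective) `r`-coloring of `ℤ/nℤ` has a rainbow solution. -/
def ForcesRainbow (n : ℕ) (a₁ a₂ a₃ b : ℤ) (r : ℕ) : Prop :=
  ∀ c : ZMod n → Fin r, Function.Surjective c → HasRainbowSolution n a₁ a₂ a₃ b c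

/-- The rainbow number: the smallest positive `r` such that every exact `r`-coloring of `ℤ/nℤ`
has a rainbow solution. There is no exact `(n + 1)`-coloring, so `r = n + 1` always qualifies
(vacuously) and the value is `n + 1` when no smaller positive `r` qualifies. -/
noncomputable def rb (n : ℕ) (a₁ a₂ a₃ b : ℤ) : ℕ :=
  sInf {r : ℕ | 0 < r ∧ ForcesRainbow n a₁ a₂ a₃ b r}

/-- The minimum in the definition of `rb` is attained. -/
theorem rb_isLeast (n : ℕ) (hn : n ≠ 0) (a₁ a₂ a₃ b : ℤ) :
    IsLeast {r : ℕ | 0 < r ∧ ForcesRainbow n a₁ a₂ a₃ b r} (rb n a₁ a₂ a₃ b) := by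
  have hne : {r : ℕ | 0 < r ∧ ForcesRainbow n a₁ a₂ a₃ b r}.Nonempty := by
    refine ⟨n + 1, n.succ_pos, fun c hc => ?_⟩
    have : NeZero n := ⟨hn⟩
    have h := Fintype.card_le_of_surjective c hc
    rw [ZMod.card, Fintype.card_fin] at h
    omega
  exact ⟨Nat.sInf_mem hne, fun r hr => Nat.sInf_le hr⟩

/-! The bound comes from a product construction. Let t solve (a₁ + a₂ + a₃)t = b. Given a
rainbow-free coloring of ℤ/pℤ in which t is alone in its class and a rainbow-free coloring of ℤ/mℤ,
color ℤ/pmℤ by the first off the coset t + pℤ and by the second, with new colors, on it. A solution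
with two entries in the coset has its third there too, and solutions inside the coset come from
solutions modulo m. Starting from one color on ℤ/1ℤ, each prime factor adds rb(p) - 2 colors,
provided ℤ/pℤ has such a coloring with rb(p) - 1 colors.

Two facts about primes supply it. First, rb(p) ≤ 4 (`forcesRainbow_four`). Dividing by the
coefficients gives three colorings with equal class sizes and the equation x + y + z = 0, so the
sumset of two classes X ≠ Y fits into |X| + |Y| points. Pollard's theorem makes the smallest of four
classes smaller than the others by at least 2; Vosper's theorem makes it a progression unless it is
a single point; neither case leaves room for three further colors.

Second, if rb(p) = 4, the subgroup H generated by the ratios -aᵢ/aⱼ is proper, and the classes {t},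
t + H and the rest are rainbow-free. If H were everything (`exists_rainbow_of_closure_eq_top`; p = 3
is checked directly), the quotient of two classes of a rainbow-free 3-coloring in the group algebra
𝔽_p[ℤ/pℤ] would be invariant under scaling by squares, hence a combination of a constant, a delta at
0 and the quadratic character. Then a polynomial of degree (p - 1)/2 takes exactly three values,
which forces it to be c(x - r)^((p - 1)/2) + s. The classes are {r} and the translates by r of
squares and nonsquares, and a rainbow solution is explicit. -/

namespace ZModSumset

/-! ### Sumsets in ℤ/pℤ: representation counts and Pollard's theorem. -/

open Finset
open scoped Pointwise

variable {p : ℕ} [Fact p.Prime]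

/-- The translate `S + t`. -/
def shift (t : ZMod p) (S : Finset (ZMod p)) : Finset (ZMod p) := S.image (· + t)

@[simp] theorem mem_shift {t x : ZMod p} {S : Finset (ZMod p)} : x ∈ shift t S ↔ x - t ∈ S := by
  simp only [shift, mem_image]
  constructor
  · rintro ⟨y, hy, rfl⟩; simpa using hy
  · intro h; exact ⟨x - t, h, by ring⟩

@[simp] theorem card_shift (t : ZMod p) (S : Finset (ZMod p)) : #(shift t S) = #S :=
  card_image_of_injective _ (add_left_injective t)

theorem card_le_prime (S : Finset (ZMod p)) : #S ≤ p := by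
  simpa [ZMod.card] using card_le_univ S

theorem card_compl_add (S : Finset (ZMod p)) : #Sᶜ + #S = p := by
  have := card_compl_add_card S
  rwa [ZMod.card] at this

theorem eq_univ_of_add_closed {S : Finset (ZMod p)} (hS : S.Nonempty) {d : ZMod p} (hd : d ≠ 0)
    (h : ∀ x ∈ S, x + d ∈ S) : S = univ := by
  obtain ⟨a, ha⟩ := hS
  have key : ∀ k : ℕ, a + k * d ∈ S := by
    intro k
    induction k with
    | zero => simpa using ha
    | succ k ih =>
      have := h _ ih
      push_cast
      convert this using 1
      ring
  ext x
  simp only [mem_univ, iff_true]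
  have := key (((x - a) / d).val)
  rw [ZMod.natCast_zmod_val, div_mul_cancel₀ _ hd] at this
  simpa using this

theorem card_add_ge {S T : Finset (ZMod p)} (hS : S.Nonempty) (hT : T.Nonempty)
    (h : #(S + T) < p) : #S + #T ≤ #(S + T) + 1 := by
  have := ZMod.cauchy_davenport (Fact.out : p.Prime) hS hT
  omega

/-- The number of representations of `w` as a sum of an element of `A` and an element of `B`. -/
def rep (A B : Finset (ZMod p)) (w : ZMod p) : ℕ := #{x ∈ A | w - x ∈ B}

theorem rep_comm (A B : Finset (ZMod p)) (w : ZMod p) : rep A B w = rep B A w := by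
  unfold rep
  refine card_bij (fun x _ => w - x) ?_ ?_ ?_
  · intro x hx
    simp only [mem_filter] at hx ⊢
    exact ⟨hx.2, by simpa using hx.1⟩
  · intro x _ y _ h
    simpa using h
  · intro y hy
    simp only [mem_filter] at hy
    exact ⟨w - y, by simp [hy.1, hy.2], by ring⟩

theorem rep_union_left {A A' : Finset (ZMod p)} (h : Disjoint A A') (B : Finset (ZMod p))
    (w : ZMod p) : rep (A ∪ A') B w = rep A B w + rep A' B w := by
  unfold rep
  rw [filter_union, card_union_of_disjoint (disjoint_filter_filter h)]

theorem rep_union_right {B B' : Finset (ZMod p)} (h : Disjoint B B') (A : Finset (ZMod p))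
    (w : ZMod p) : rep A (B ∪ B') w = rep A B w + rep A B' w := by
  rw [rep_comm, rep_union_left h, rep_comm B, rep_comm B']

theorem rep_le_left (A B : Finset (ZMod p)) (w : ZMod p) : rep A B w ≤ #A :=
  card_filter_le _ _

theorem rep_le_right (A B : Finset (ZMod p)) (w : ZMod p) : rep A B w ≤ #B := by
  rw [rep_comm]; exact rep_le_left _ _ _

theorem sum_rep (A B W : Finset (ZMod p)) :
    ∑ w ∈ W, rep A B w = #{q ∈ A ×ˢ B | q.1 + q.2 ∈ W} := by
  rw [card_eq_sum_card_fiberwise (f := fun q : ZMod p × ZMod p => q.1 + q.2) (t := W)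
    (fun q hq => by simpa using (mem_filter.1 hq).2)]
  refine sum_congr rfl fun w hw => ?_
  unfold rep
  refine card_bij (fun x _ => (x, w - x)) ?_ ?_ ?_
  · intro x hx
    simp only [mem_filter, mem_product] at hx ⊢
    refine ⟨⟨hx, ?_⟩, by ring⟩
    simpa using hw
  · intro x _ y _ h
    exact (Prod.ext_iff.1 h).1
  · rintro ⟨x, y⟩ hq
    simp only [mem_filter, mem_product] at hq
    obtain ⟨⟨⟨hx, hy⟩, _⟩, rfl⟩ := hq
    exact ⟨x, by simp [hx, hy], by simp⟩

theorem sum_rep_univ (A B : Finset (ZMod p)) : ∑ w, rep A B w = #A * #B := by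
  rw [sum_rep]; simp

theorem sum_min_rep_shift (A B : Finset (ZMod p)) (t : ℕ) (g : ZMod p) :
    ∑ w, min t (rep A (shift g B) w) = ∑ w, min t (rep A B w) := by
  refine Fintype.sum_equiv (Equiv.subRight g) _ _ fun w => ?_
  simp only [rep, mem_shift, Equiv.subRight_apply]
  congr 3
  ext x
  rw [sub_right_comm]

/-- Dyson's transform (A, B) ↦ (A ∪ B, A ∩ B) made exact: the representations it loses are those by
the two set differences. -/
theorem rep_dyson (A B : Finset (ZMod p)) (w : ZMod p) :
    rep A B w = rep (A ∪ B) (A ∩ B) w + rep (A \ B) (B \ A) w := by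
  have hA : A = A \ B ∪ A ∩ B := (sdiff_union_inter A B).symm
  have hB : B = B \ A ∪ A ∩ B := by rw [inter_comm]; exact (sdiff_union_inter B A).symm
  have hU : A ∪ B = A \ B ∪ B := (sdiff_union_self_eq_union).symm
  have d1 : Disjoint (A \ B) (A ∩ B) := disjoint_sdiff_inter A B
  have d2 : Disjoint (B \ A) (A ∩ B) := by rw [inter_comm]; exact disjoint_sdiff_inter B A
  have e1 : rep A B w = rep (A \ B) B w + rep (A ∩ B) B w := by
    conv_lhs => rw [hA]
    exact rep_union_left d1 _ _
  have e2 : rep (A \ B) B w = rep (A \ B) (B \ A) w + rep (A \ B) (A ∩ B) w := by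
    rw [← rep_union_right d2, ← hB]
  have e3 : rep (A ∪ B) (A ∩ B) w = rep (A \ B) (A ∩ B) w + rep B (A ∩ B) w := by
    rw [hU]; exact rep_union_left sdiff_disjoint _ _
  rw [e1, e2, e3, rep_comm (A ∩ B) B]
  ring

/-- **Pollard's theorem**. -/
theorem pollard (t : ℕ) (A B : Finset (ZMod p)) (hA : t ≤ #A) (hB : t ≤ #B)
    (hp : #A + #B ≤ p + t) : t * (#A + #B) ≤ ∑ w, min t (rep A B w) + t * t := by
  induction hn : #B using Nat.strong_induction_on generalizing t A B with
  | _ n ih =>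
    subst hn
    have base : ∀ A B : Finset (ZMod p), ∑ w, min #B (rep A B w) = #A * #B := by
      intro A B
      rw [← sum_rep_univ]
      exact sum_congr rfl fun w _ => min_eq_right (rep_le_right _ _ _)
    rcases hB.eq_or_lt with h | hlt
    · rw [h, base]; nlinarith
    rcases Nat.eq_zero_or_pos t with h0 | hpos
    · simp [h0]
    have hAu : A ≠ univ := by
      rintro rfl
      rw [card_univ, ZMod.card] at hp
      omega
    -- For this translate the intersection with `A` is nonempty and smaller than `B`, so induction
    -- on `#B` applies both to the intersection and to the difference.
    obtain ⟨g, hne, hns⟩ : ∃ g, (A ∩ shift g B).Nonempty ∧ ¬ shift g B ⊆ A := by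
      by_contra! hcon
      obtain ⟨b, hb, b', hb', hbb⟩ := one_lt_card.1 (show 1 < #B by omega)
      refine hAu (eq_univ_of_add_closed (card_pos.1 (by omega)) (sub_ne_zero.2 hbb.symm) ?_)
      intro x hx
      refine hcon (x - b) ⟨x, by simp [hx, hb]⟩ ?_
      simp only [mem_shift]
      convert hb' using 1
      ring
    rw [← sum_min_rep_shift A B t g, ← card_shift g B]
    set B' := shift g B
    have hB' : #B' = #B := card_shift g B
    have hI : #(A ∩ B') < #B' :=
      card_lt_card ⟨inter_subset_right, fun h => hns fun x hx => (mem_inter.1 (h hx)).1⟩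
    have hI0 : 0 < #(A ∩ B') := card_pos.2 hne
    have hUI := card_union_add_card_inter A B'
    have hAd := card_sdiff_add_card_inter A B'
    have hBd := card_sdiff_add_card_inter B' A
    rw [inter_comm B' A] at hBd
    rcases le_or_gt t #(A ∩ B') with hc | hc
    · have := ih _ (by omega) t (A ∪ B') (A ∩ B') (by omega) hc (by omega) rfl
      rw [hUI] at this
      refine this.trans (Nat.add_le_add_right (sum_le_sum fun w _ => ?_) _)
      rw [rep_dyson A B']
      exact min_le_min_left _ (Nat.le_add_right _ _)
    -- The union and intersection contribute their full count; the rest of the cap, `t - #(A ∩ B')`,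
    -- goes to the differences.
    · have h2 := ih _ (by omega) (t - #(A ∩ B')) (A \ B') (B' \ A) (by omega) (by omega)
        (by omega) rfl
      have h1 := base (A ∪ B') (A ∩ B')
      have h3 : ∑ w, min #(A ∩ B') (rep (A ∪ B') (A ∩ B') w)
          + ∑ w, min (t - #(A ∩ B')) (rep (A \ B') (B' \ A) w) ≤ ∑ w, min t (rep A B' w) := by
        rw [← sum_add_distrib]
        refine sum_le_sum fun w _ => ?_
        rw [rep_dyson A B']
        omega
      rw [h1] at h3
      obtain ⟨k, hk⟩ : ∃ k, t = #(A ∩ B') + k := ⟨t - #(A ∩ B'), by omega⟩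
      rw [show t - #(A ∩ B') = k by omega] at h2 h3
      rw [← hUI]
      have e : #(A \ B') + #(B' \ A) + #(A ∩ B') = #(A ∪ B') := by omega
      have e' : t * (#(A ∪ B') + #(A ∩ B')) + k * k
          = #(A ∪ B') * #(A ∩ B') + k * (#(A \ B') + #(B' \ A)) + t * t := by
        rw [← e, hk]; ring
      omega

/-! ### Critical pairs, Vosper's theorem and arithmetic progressions. -/

/-- `S` is an arithmetic progression of difference `d` (possibly degenerate). -/
def IsArc (d : ZMod p) (S : Finset (ZMod p)) : Prop := #(S ∪ shift d S) ≤ #S + 1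

theorem add_pair (S : Finset (ZMod p)) (m d : ZMod p) :
    S + {m, m + d} = shift m (S ∪ shift d S) := by
  ext x
  simp only [mem_add, mem_insert, mem_singleton, mem_shift, mem_union]
  constructor
  · rintro ⟨y, hy, z, rfl | rfl, rfl⟩
    · left; simpa using hy
    · right; convert hy using 1; ring
  · rintro (h | h)
    · exact ⟨_, h, m, Or.inl rfl, by ring⟩
    · exact ⟨_, h, m + d, Or.inr rfl, by ring⟩

/-- The pair `S, F` attains equality in the Cauchy–Davenport theorem, in a nontrivial way. -/
structure Critical (S F : Finset (ZMod p)) : Prop where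
  left : 2 ≤ #S
  right : 2 ≤ #F
  le : #(S + F) + 1 ≤ #S + #F
  lt : #(S + F) + 2 ≤ p

theorem Critical.symm {S F : Finset (ZMod p)} (h : Critical S F) : Critical F S where
  left := h.right
  right := h.left
  le := by rw [add_comm F S, add_comm #F]; exact h.le
  lt := by rw [add_comm F S]; exact h.lt

theorem Critical.card_eq {S F : Finset (ZMod p)} (h : Critical S F) :
    #(S + F) + 1 = #S + #F := by
  have := card_add_ge (card_pos.1 (by have := h.left; omega) : S.Nonempty)
    (card_pos.1 (by have := h.right; omega) : F.Nonempty) (by have := h.lt; omega)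
  have := h.le
  omega

theorem Critical.of_subset {S F T : Finset (ZMod p)} (hS : 2 ≤ #S) (hF : 2 ≤ #F)
    (hT : S + F ⊆ T) (h1 : #T + 1 ≤ #S + #F) (h2 : #T + 2 ≤ p) : Critical S F :=
  ⟨hS, hF, by have := card_le_card hT; omega, by have := card_le_card hT; omega⟩

theorem shift_inter_ssubset {M : Finset (ZMod p)} (hM : M.Nonempty) (hM' : M ≠ univ) {t : ZMod p}
    (ht : t ≠ 0) : #(M ∩ shift t M) < #M := by
  refine card_lt_card ⟨inter_subset_left, fun h => hM' ?_⟩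
  refine eq_univ_of_add_closed hM (neg_ne_zero.2 ht) fun x hx => ?_
  have := (mem_inter.1 (h hx)).2
  rw [mem_shift] at this
  simpa [sub_eq_add_neg] using this

/-- Hamidoune's atoms: take `M` of least size. If `M` met a translate in two points, minimality
would make the intersection non-critical, and submodularity of F ↦ |S + F| would put the union below
the Cauchy–Davenport bound. The dual set -(S + M)ᶜ is also critical, hence no smaller than `M`,
which keeps the sumset of the union below `p` elements. -/
theorem exists_atom {S F : Finset (ZMod p)} (h : Critical S F) :
    ∃ M, Critical S M ∧ ∀ t ≠ 0, #(M ∩ shift t M) ≤ 1 := by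
  classical
  obtain ⟨M, hM, hmin⟩ := exists_min_image (univ.filter fun F => Critical S F) card
    ⟨F, by simpa using h⟩
  simp only [mem_filter, mem_univ, true_and] at hM hmin
  refine ⟨M, hM, fun t ht => ?_⟩
  by_contra! hI
  have hSn : S.Nonempty := card_pos.1 (by have := hM.left; omega)
  have hMn : M.Nonempty := card_pos.1 (by have := hM.right; omega)
  have hcard := hM.card_eq
  have hMS : #M ≤ #(S + M) := by
    rw [add_comm]; exact card_le_card_add_right hSn
  have hlt := hM.lt
  have hMu : M ≠ univ := by
    rintro rfl
    rw [card_univ, ZMod.card] at hMS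
    omega
  have hr := hM.right
  have hl := hM.left
  -- the dual fragment
  have hdual : 2 * #M + #S ≤ p + 1 := by
    have hD := card_compl_add (S + M)
    have hMc := card_compl_add (-M)
    rw [card_neg] at hMc
    have hsub : S + -(S + M)ᶜ ⊆ (-M)ᶜ := by
      intro x hx
      obtain ⟨s, hs, y, hy, rfl⟩ := mem_add.1 hx
      simp only [mem_neg', mem_compl] at hy ⊢
      intro hm
      refine hy (mem_add.2 ⟨s, hs, _, hm, by ring⟩)
    have := hmin (-(S + M)ᶜ) (Critical.of_subset hl (by rw [card_neg]; omega) hsub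
      (by rw [card_neg]; omega) (by omega))
    rw [card_neg] at this
    omega
  have hIlt := shift_inter_ssubset hMn hMu ht
  have hUI := card_union_add_card_inter M (shift t M)
  rw [card_shift] at hUI
  have hSt : S + shift t M = shift t (S + M) := by
    ext x
    simp only [mem_add, mem_shift]
    constructor
    · rintro ⟨y, hy, z, hz, rfl⟩
      exact ⟨y, hy, _, hz, by ring⟩
    · rintro ⟨y, hy, z, hz, e⟩
      exact ⟨y, hy, z + t, by simpa using hz, by rw [← add_assoc, e]; ring⟩
  have hsubI : S + M ∩ shift t M ⊆ (S + M) ∩ (S + shift t M) :=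
    subset_inter (add_subset_add_left inter_subset_left) (add_subset_add_left inter_subset_right)
  have hU : S + (M ∪ shift t M) = (S + M) ∪ (S + shift t M) := add_union
  have hsm := card_union_add_card_inter (S + M) (S + shift t M)
  rw [← hU] at hsm
  have hcs : #(S + shift t M) = #(S + M) := by rw [hSt, card_shift]
  have hIc := card_le_card hsubI
  have hIc' : #(S + M ∩ shift t M) ≤ #(S + M) :=
    card_le_card (add_subset_add_left inter_subset_left)
  have hnI : #S + #(M ∩ shift t M) ≤ #(S + M ∩ shift t M) := by
    by_contra! hc
    have := hmin _ ⟨hl, hI, by omega, by omega⟩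
    omega
  have hUc := ZMod.cauchy_davenport (Fact.out : p.Prime) hSn (hMn.mono subset_union_left :
    (M ∪ shift t M).Nonempty)
  omega

theorem three_mul_card_le {S M : Finset (ZMod p)} (hS : 3 ≤ #S)
    (hM : ∀ t ≠ 0, #(M ∩ shift t M) ≤ 1) : 3 * #M ≤ #(S + M) + 3 := by
  obtain ⟨x, hx, y, hy, z, hz, hxy, hxz, hyz⟩ := two_lt_card.1 hS
  have hint : ∀ a b : ZMod p, a ≠ b → #(shift a M ∩ shift b M) ≤ 1 := by
    intro a b hab
    have : shift a M ∩ shift b M = shift a (M ∩ shift (b - a) M) := by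
      ext w
      simp only [mem_inter, mem_shift]
      rw [show w - a - (b - a) = w - b by ring]
    rw [this, card_shift]
    exact hM _ (sub_ne_zero.2 hab.symm)
  have hsub : shift x M ∪ shift y M ∪ shift z M ⊆ S + M := by
    intro w hw
    simp only [mem_union, mem_shift] at hw
    rcases hw with (h | h) | h
    · exact mem_add.2 ⟨x, hx, _, h, by ring⟩
    · exact mem_add.2 ⟨y, hy, _, h, by ring⟩
    · exact mem_add.2 ⟨z, hz, _, h, by ring⟩
  have h1 := card_union_add_card_inter (shift x M) (shift y M)
  have h2 := card_union_add_card_inter (shift x M ∪ shift y M) (shift z M)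
  rw [union_inter_distrib_right] at h2
  have h3 := card_union_le (shift x M ∩ shift z M) (shift y M ∩ shift z M)
  have := hint _ _ hxy
  have := hint _ _ hxz
  have := hint _ _ hyz
  have := card_le_card hsub
  simp only [card_shift] at *
  omega

theorem isArc_of_critical_pair {S M : Finset (ZMod p)} (h : Critical S M) (hM : #M = 2) :
    ∃ d ≠ 0, IsArc d S ∧ ∃ m, M = {m, m + d} := by
  obtain ⟨m, n, hmn, rfl⟩ := card_eq_two.1 hM
  refine ⟨n - m, sub_ne_zero.2 hmn.symm, ?_, m, by simp⟩
  have h1 := h.le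
  rw [show n = m + (n - m) by ring, add_pair, card_shift, ← show n = m + (n - m) by ring, hM] at h1
  unfold IsArc
  omega

/-- Replacing `S` by `S ∩ (S - d)` costs one element and makes room for `F ∪ (F + d)` in the same
sumset; Cauchy–Davenport bounds that union. -/
theorem Critical.isArc_of_isArc {S F : Finset (ZMod p)} (h : Critical S F) {d : ZMod p}
    (hd : IsArc d S) : IsArc d F := by
  have hFn : F.Nonempty := card_pos.1 (by have := h.right; omega)
  have hl := h.left
  have hlt := h.lt
  have hle := h.le
  have hS₀ : #S ≤ #(S ∩ shift (-d) S) + 1 := by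
    have e : #(S ∪ shift (-d) S) = #(S ∪ shift d S) := by
      rw [← card_shift d (S ∪ shift (-d) S)]
      congr 1
      ext x
      simp [or_comm]
    have := card_union_add_card_inter S (shift (-d) S)
    rw [card_shift, e] at this
    unfold IsArc at hd
    omega
  set S₀ := S ∩ shift (-d) S
  have hsub : S₀ + (F ∪ shift d F) ⊆ S + F := by
    intro x hx
    obtain ⟨s, hs, f, hf, rfl⟩ := mem_add.1 hx
    simp only [S₀, mem_inter, mem_shift, sub_neg_eq_add, mem_union] at hs hf
    rcases hf with hf | hf
    · exact add_mem_add hs.1 hf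
    · exact mem_add.2 ⟨_, hs.2, _, hf, by ring⟩
  have hc := card_le_card hsub
  have := card_add_ge (S := S₀) (T := F ∪ shift d F) (card_pos.1 (by omega))
    (hFn.mono subset_union_left) (by omega)
  unfold IsArc
  omega

/-- **Vosper's theorem**. -/
theorem Critical.exists_isArc {S F : Finset (ZMod p)} (h : Critical S F) :
    ∃ d ≠ 0, IsArc d S := by
  obtain ⟨M, hM, hMt⟩ := exists_atom h
  rcases (show #M = 2 ∨ 3 ≤ #M by have := hM.right; omega) with h2 | h3
  · obtain ⟨d, hd, h, -⟩ := isArc_of_critical_pair hM h2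
    exact ⟨d, hd, h⟩
  rcases (show #S = 2 ∨ 3 ≤ #S by have := hM.left; omega) with hS2 | hS3
  · obtain ⟨d, hd, h, -⟩ := isArc_of_critical_pair hM.symm hS2
    exact ⟨d, hd, hM.symm.isArc_of_isArc h⟩
  obtain ⟨N, hN, hNt⟩ := exists_atom hM.symm
  have hSM := hM.card_eq
  have hMN := hN.card_eq
  rcases (show #N = 2 ∨ 3 ≤ #N by have := hN.right; omega) with h2 | h3'
  · obtain ⟨d, hd, h, -⟩ := isArc_of_critical_pair hN h2
    have h1 := hMt d hd
    have := card_union_add_card_inter M (shift d M)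
    rw [card_shift] at this
    unfold IsArc at h
    omega
  -- With |M + N| = |M| + |N| - 1 the two estimates add up to |M| + |N| ≤ 4.
  · have h1 := three_mul_card_le h3 hNt
    have h2 := three_mul_card_le h3' hMt
    rw [add_comm N M] at h2
    omega

theorem card_add_card_le_of_not_isArc {S F T : Finset (ZMod p)} (hS : 2 ≤ #S)
    (hS' : ∀ d ≠ 0, ¬ IsArc d S) (hF : 2 ≤ #F) (hT : S + F ⊆ T) (h : #T + 2 ≤ p) :
    #S + #F ≤ #(S + F) := by
  by_contra! hc
  obtain ⟨d, hd, h⟩ := (⟨hS, hF, hc, by have := card_le_card hT; omega⟩ :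
    Critical S F).exists_isArc
  exact hS' d hd h

theorem exists_start {S : Finset (ZMod p)} (hS : S.Nonempty) (hS' : S ≠ univ) {d : ZMod p}
    (hd : d ≠ 0) : ∃ x ∈ S, x - d ∉ S := by
  by_contra! hc
  exact hS' (eq_univ_of_add_closed hS (neg_ne_zero.2 hd) fun x hx => by
    simpa [sub_eq_add_neg] using hc x hx)

theorem IsArc.start_unique {S : Finset (ZMod p)} {d : ZMod p} (h : IsArc d S) {x y : ZMod p}
    (hx : x ∈ S) (hx' : x - d ∉ S) (hy : y ∈ S) (hy' : y - d ∉ S) : x = y := by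
  have h1 : #(shift d S \ S) ≤ 1 := by
    have := card_sdiff_add_card (shift d S) S
    rw [union_comm] at this
    unfold IsArc at h
    omega
  have h2 : #(S \ shift d S) ≤ 1 := by
    have := card_sdiff_add_card_inter (shift d S) S
    have h3 := card_sdiff_add_card_inter S (shift d S)
    rw [inter_comm] at h3
    rw [card_shift] at this
    omega
  exact card_le_one.1 h2 x (by simp [hx, hx']) y (by simp [hy, hy'])

theorem IsArc.eq_image {S : Finset (ZMod p)} (hS : S.Nonempty) (hS' : S ≠ univ) {d : ZMod p}
    (hd : d ≠ 0) (h : IsArc d S) : ∃ e, S = (range #S).image fun i : ℕ => e + i * d := by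
  obtain ⟨e, he, he'⟩ := exists_start hS hS' hd
  refine ⟨e, ?_⟩
  have key : ∀ k < #S, ∀ i ≤ k, e + i * d ∈ S := by
    intro k
    induction k with
    | zero => intro _ i hi; obtain rfl := Nat.le_zero.1 hi; simpa using he
    | succ k ih =>
      intro hk i hi
      rcases Nat.lt_or_ge i (k + 1) with hik | hik
      · exact ih (by omega) i (by omega)
      obtain rfl : i = k + 1 := by omega
      by_contra hcon
      set I := (range (k + 1)).image fun i : ℕ => e + i * d with hI
      have hIc : #I ≤ k + 1 := card_image_le.trans (card_range _).le
      have hne : (S \ I).Nonempty := by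
        rw [sdiff_nonempty]
        intro hsub
        have := card_le_card hsub
        omega
      -- Such a `y` is either the successor of a point of the run `I`, or a second starting point of
      -- `S`; both are impossible.
      obtain ⟨y, hy, hy'⟩ := exists_start hne (fun hu => hS'
        (univ_subset_iff.1 (hu ▸ sdiff_subset))) hd
      simp only [mem_sdiff] at hy
      by_cases hyd : y - d ∈ S
      · have hyI : y - d ∈ I := by
          by_contra hyI
          exact hy' (mem_sdiff.2 ⟨hyd, hyI⟩)
        obtain ⟨j, hj, hje⟩ := mem_image.1 hyI
        have hyj : y = e + ((j + 1 : ℕ) : ZMod p) * d := by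
          push_cast
          linear_combination -hje
        rcases Nat.lt_or_ge (j + 1) (k + 1) with hjk | hjk
        · exact hy.2 (hyj ▸ mem_image.2 ⟨j + 1, mem_range.2 hjk, rfl⟩)
        · obtain rfl : j = k := by have := mem_range.1 hj; omega
          exact hcon (hyj ▸ hy.1)
      · have := h.start_unique he he' hy.1 hyd
        exact hy.2 (this ▸ mem_image.2 ⟨0, by simp, by simp⟩)
  have hinj : Set.InjOn (fun i : ℕ => e + i * d) (range #S) := by
    intro i hi j hj hij
    have hij' : (i : ZMod p) = j := by
      have : ((i : ZMod p) - j) * d = 0 := by linear_combination hij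
      exact sub_eq_zero.1 ((mul_eq_zero.1 this).resolve_right hd)
    have hc := card_le_prime S
    have hi := mem_range.1 hi
    have hj := mem_range.1 hj
    have := (ZMod.natCast_eq_natCast_iff' _ _ _).1 hij'
    rwa [Nat.mod_eq_of_lt (by omega), Nat.mod_eq_of_lt (by omega)] at this
  symm
  refine eq_of_subset_of_card_le ?_ ?_
  · intro x hx
    obtain ⟨i, hi, rfl⟩ := mem_image.1 hx
    have := mem_range.1 hi
    exact key i this i le_rfl
  · rw [card_image_of_injOn hinj, card_range]

end ZModSumset

/-! ### Rainbow-free triples: additive structure and class sizes. -/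

namespace RainbowFree

open Finset ZModSumset
open scoped Pointwise

set_option linter.unusedSectionVars false

variable {p : ℕ} [Fact p.Prime] {κ : Type*} [DecidableEq κ]

/-- The color class of `X`. -/
def cls (c : ZMod p → κ) (X : κ) : Finset (ZMod p) := univ.filter (c · = X)

@[simp] theorem mem_cls {c : ZMod p → κ} {X : κ} {x : ZMod p} : x ∈ cls c X ↔ c x = X := by
  simp [cls]

theorem disjoint_cls (c : ZMod p → κ) {X Y : κ} (h : X ≠ Y) : Disjoint (cls c X) (cls c Y) := by
  rw [disjoint_left]
  intro x hx hy
  simp only [mem_cls] at hx hy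
  exact h (hx.symm.trans hy)

/-- Three colorings with equal class sizes such that `x + y + z = 0` has no solution in which
`x`, `y`, `z` receive pairwise distinct colors. -/
structure RF (n : κ → ℕ) (c₁ c₂ c₃ : ZMod p → κ) : Prop where
  rf : ∀ x y z, x + y + z = 0 → c₁ x = c₂ y ∨ c₁ x = c₃ z ∨ c₂ y = c₃ z
  card₁ : ∀ X, #(cls c₁ X) = n X
  card₂ : ∀ X, #(cls c₂ X) = n X
  card₃ : ∀ X, #(cls c₃ X) = n X

variable {n : κ → ℕ} {c₁ c₂ c₃ : ZMod p → κ}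

theorem RF.swap₂₃ (h : RF n c₁ c₂ c₃) : RF n c₁ c₃ c₂ where
  rf x y z e := by
    have := h.rf x z y (by rw [← e]; ring)
    tauto
  card₁ := h.card₁
  card₂ := h.card₃
  card₃ := h.card₂

theorem RF.swap₁₂ (h : RF n c₁ c₂ c₃) : RF n c₂ c₁ c₃ where
  rf x y z e := by
    have := h.rf y x z (by rw [← e]; ring)
    tauto
  card₁ := h.card₂
  card₂ := h.card₁
  card₃ := h.card₃

theorem RF.color_third (h : RF n c₁ c₂ c₃) {x y : ZMod p} (hxy : c₁ x ≠ c₂ y) :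
    c₃ (-(x + y)) = c₁ x ∨ c₃ (-(x + y)) = c₂ y := by
  have := h.rf x y (-(x + y)) (by ring)
  tauto

theorem card_cls_neg (c : ZMod p → κ) (X : κ) : #(cls (fun w => c (-w)) X) = #(cls c X) := by
  refine card_bij (fun x _ => -x) ?_ ?_ ?_
  · intro x hx; simpa using hx
  · intro x _ y _ e; simpa using e
  · intro y hy; exact ⟨-y, by simpa using hy, by simp⟩

theorem RF.card_neg₃ (h : RF n c₁ c₂ c₃) (X : κ) : #(cls (fun w => c₃ (-w)) X) = n X :=
  (card_cls_neg c₃ X).trans (h.card₃ X)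

theorem RF.add_subset (h : RF n c₁ c₂ c₃) {X Y : κ} (hXY : X ≠ Y) :
    cls c₁ X + cls c₂ Y ⊆ cls (fun w => c₃ (-w)) X ∪ cls (fun w => c₃ (-w)) Y := by
  intro w hw
  obtain ⟨x, hx, y, hy, rfl⟩ := mem_add.1 hw
  simp only [mem_cls, mem_union] at *
  subst hx hy
  exact h.color_third hXY

/-- Four distinct colors that exhaust the palette. -/
structure Four (A B C D : κ) : Prop where
  ab : A ≠ B
  ac : A ≠ C
  ad : A ≠ D
  bc : B ≠ C
  bd : B ≠ D
  cd : C ≠ D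
  cover : ∀ X, X = A ∨ X = B ∨ X = C ∨ X = D

variable {A B C D : κ}

theorem Four.swap₁₂ (h : Four A B C D) : Four B A C D :=
  ⟨h.ab.symm, h.bc, h.bd, h.ac, h.ad, h.cd, fun X => by have := h.cover X; tauto⟩

theorem Four.swap₂₃ (h : Four A B C D) : Four A C B D :=
  ⟨h.ac, h.ab, h.ad, h.bc.symm, h.cd, h.bd, fun X => by have := h.cover X; tauto⟩

theorem Four.swap₃₄ (h : Four A B C D) : Four A B D C :=
  ⟨h.ab, h.ad, h.ac, h.bd, h.bc, h.cd.symm, fun X => by have := h.cover X; tauto⟩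

theorem sum_fiber_eq (h : Four A B C D) {α : Type*} (S : Finset α) (g : α → κ) :
    #{x ∈ S | g x = A} + #{x ∈ S | g x = B} + #{x ∈ S | g x = C} + #{x ∈ S | g x = D} = #S := by
  have key := card_eq_sum_card_fiberwise (s := S) (f := g) (t := {A, B, C, D})
    (fun x _ => by simpa using h.cover (g x))
  rw [sum_insert (by simp [h.ab, h.ac, h.ad]), sum_insert (by simp [h.bc, h.bd]),
    sum_insert (by simp [h.cd]), sum_singleton] at key
  omega

theorem RF.sum_card (h : RF n c₁ c₂ c₃) (h4 : Four A B C D) : n A + n B + n C + n D = p := by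
  have := sum_fiber_eq h4 univ c₁
  rw [card_univ, ZMod.card] at this
  rw [← this, ← h.card₁, ← h.card₁, ← h.card₁, ← h.card₁]
  rfl

/-- When no solution starts at `t`, passes through `Y` and ends in `A`, adding `t` to `X` leaves the
sums with `Y` inside the same n X + n Y points: equality in Cauchy–Davenport. -/
theorem RF.critical_insert (h : RF n c₁ c₂ c₃) {X Y Z : κ} (h4 : Four A X Y Z) (hA : 1 ≤ n A)
    (hX : 1 ≤ n X) (hY : 2 ≤ n Y) (hZ : 1 ≤ n Z) {t : ZMod p} (ht : c₁ t = A)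
    (hbad : ∀ y, c₂ y = Y → c₃ (-(t + y)) ≠ A) : Critical (insert t (cls c₁ X)) (cls c₂ Y) := by
  have hsum := h.sum_card h4
  have htX : t ∉ cls c₁ X := by simpa [ht] using h4.ab
  have hcard : #(insert t (cls c₁ X)) = n X + 1 := by rw [card_insert_of_notMem htX, h.card₁]
  have hT : #(cls (fun w => c₃ (-w)) X ∪ cls (fun w => c₃ (-w)) Y) = n X + n Y := by
    rw [card_union_of_disjoint (disjoint_cls _ h4.bc), h.card_neg₃, h.card_neg₃]
  refine Critical.of_subset (by omega) (by rw [h.card₂]; exact hY)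
    (T := cls (fun w => c₃ (-w)) X ∪ cls (fun w => c₃ (-w)) Y) ?_
    (by rw [hT, hcard, h.card₂]; omega) (by omega)
  intro w hw
  obtain ⟨x, hx, y, hy, rfl⟩ := mem_add.1 hw
  rcases mem_insert.1 hx with rfl | hx
  · have hy' : c₂ y = Y := mem_cls.1 hy
    have h1 := h.color_third (x := x) (y := y) (by rw [ht, hy']; exact h4.ac)
    rw [ht, hy'] at h1
    have := hbad y hy'
    simp only [mem_union, mem_cls]
    tauto
  · exact h.add_subset h4.bc (add_mem_add hx hy)

theorem neighbor_of_isArc_insert {S : Finset (ZMod p)} {t d : ZMod p} (hd : d ≠ 0) (ht : t ∉ S)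
    (hS : S.Nonempty) (h : IsArc d (insert t S)) : t + d ∈ S ∨ t - d ∈ S := by
  by_contra! hc
  obtain ⟨y, hy, hy'⟩ := exists_start hS (by rintro rfl; simp at ht) hd
  have h1 := h.start_unique (x := t) (y := y) (by simp) (by simp [hd, hc.2]) (by simp [hy]) (by
    rw [mem_insert, not_or]
    refine ⟨fun e => hc.1 ?_, hy'⟩
    rw [← e]; simpa using hy)
  exact ht (h1 ▸ hy)

/-- By Vosper, `{t} ∪ P`, `{t} ∪ Q` and `{t} ∪ R` are progressions with a common difference `d`, so
each of the three colors must appear at `t + d` or `t - d`. -/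
theorem RF.two_bad (h : RF n c₁ c₂ c₃) {P Q R : κ} (h4 : Four A P Q R) (hA : 1 ≤ n A)
    (hP : 2 ≤ n P) (hQ : 2 ≤ n Q) (hR : 2 ≤ n R) {t : ZMod p} (ht : c₁ t = A)
    (hbP : ∀ y, c₂ y = P → c₃ (-(t + y)) ≠ A) (hbQ : ∀ y, c₂ y = Q → c₃ (-(t + y)) ≠ A) :
    False := by
  have k1 := h.critical_insert (X := Q) (Y := P) h4.swap₂₃ hA (by omega) hP (by omega) ht hbP
  have k2 := h.critical_insert (X := R) (Y := P) h4.swap₃₄.swap₂₃ hA (by omega) hP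
    (by omega) ht hbP
  have k3 := h.critical_insert (X := P) (Y := Q) h4 hA (by omega) hQ (by omega) ht hbQ
  have k4 := h.critical_insert (X := R) (Y := Q) h4.swap₃₄.swap₂₃.swap₃₄ hA
    (by omega) hQ (by omega) ht hbQ
  obtain ⟨d, hd, a1⟩ := k1.symm.exists_isArc
  have aQ := k1.symm.isArc_of_isArc a1
  have aR := k2.symm.isArc_of_isArc a1
  have aP := k3.symm.isArc_of_isArc (k4.isArc_of_isArc aR)
  have key : ∀ X, A ≠ X → 2 ≤ n X → IsArc d (insert t (cls c₁ X)) →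
      c₁ (t + d) = X ∨ c₁ (t - d) = X := by
    intro X hAX hX ha
    have := neighbor_of_isArc_insert hd (by simpa [ht] using hAX)
      (card_pos.1 (by rw [h.card₁]; omega)) ha
    simpa using this
  have e1 := key P h4.ab hP aP
  have e2 := key Q h4.ac hQ aQ
  have e3 := key R h4.ad hR aR
  have := h4.bc
  have := h4.bd
  have := h4.cd
  grind

/-! ### Counting solutions by their colors -/

/-- The number of solutions of `x + y + z = 0` with colors `X`, `Y`, `Z`. -/
def cnt (c₁ c₂ c₃ : ZMod p → κ) (X Y Z : κ) : ℕ :=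
  #{q ∈ cls c₁ X ×ˢ cls c₂ Y | c₃ (-(q.1 + q.2)) = Z}

theorem cnt_swap₁₂ (c₁ c₂ c₃ : ZMod p → κ) (X Y Z : κ) :
    cnt c₁ c₂ c₃ X Y Z = cnt c₂ c₁ c₃ Y X Z := by
  refine card_bij (fun q _ => (q.2, q.1)) ?_ ?_ ?_
  · rintro ⟨x, y⟩ hq
    simp only [mem_filter, mem_product, mem_cls] at hq ⊢
    rw [add_comm y x]
    tauto
  · rintro ⟨x, y⟩ _ ⟨x', y'⟩ _ e
    simp only [Prod.mk.injEq] at e ⊢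
    tauto
  · rintro ⟨x, y⟩ hq
    simp only [mem_filter, mem_product, mem_cls] at hq
    refine ⟨(y, x), ?_, rfl⟩
    simp only [mem_filter, mem_product, mem_cls]
    rw [add_comm y x]
    tauto

theorem cnt_swap₂₃ (c₁ c₂ c₃ : ZMod p → κ) (X Y Z : κ) :
    cnt c₁ c₂ c₃ X Y Z = cnt c₁ c₃ c₂ X Z Y := by
  refine card_bij (fun q _ => (q.1, -(q.1 + q.2))) ?_ ?_ ?_
  · rintro ⟨x, y⟩ hq
    simp only [mem_filter, mem_product, mem_cls] at hq ⊢
    rw [show -(x + -(x + y)) = y by ring]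
    tauto
  · rintro ⟨x, y⟩ _ ⟨x', y'⟩ _ e
    simp only [Prod.mk.injEq, neg_inj] at e ⊢
    obtain ⟨rfl, e⟩ := e
    exact ⟨rfl, add_left_cancel e⟩
  · rintro ⟨x, y⟩ hq
    simp only [mem_filter, mem_product, mem_cls] at hq
    refine ⟨(x, -(x + y)), ?_, by simp⟩
    simp only [mem_filter, mem_product, mem_cls]
    rw [show -(x + -(x + y)) = y by ring]
    tauto

theorem RF.cnt_add (h : RF n c₁ c₂ c₃) {X Y : κ} (hXY : X ≠ Y) :
    cnt c₁ c₂ c₃ X Y X + cnt c₁ c₂ c₃ X Y Y = n X * n Y := by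
  unfold cnt
  rw [← h.card₁, ← h.card₂, ← card_product, ← card_union_of_disjoint
    (disjoint_filter.2 fun q _ h1 h2 => hXY (h1.symm.trans h2)), ← filter_or, filter_true_of_mem]
  rintro ⟨x, y⟩ hq
  simp only [mem_product, mem_cls] at hq
  obtain ⟨rfl, rfl⟩ := hq
  exact h.color_third hXY

/-- Both counts complement the count for `X, Y, Y` to n X · n Y. -/
theorem RF.cnt_comm (h : RF n c₁ c₂ c₃) {X Y : κ} (hXY : X ≠ Y) :
    cnt c₁ c₂ c₃ X Y X = cnt c₁ c₂ c₃ X X Y := by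
  have h1 := h.cnt_add hXY
  have h2 := h.swap₂₃.cnt_add hXY
  rw [← cnt_swap₂₃ c₁ c₂ c₃ X X Y, ← cnt_swap₂₃ c₁ c₂ c₃ X Y Y] at h2
  omega

theorem RF.cnt_diag_add (h : RF n c₁ c₂ c₃) {X Y : κ} (hXY : X ≠ Y) :
    cnt c₁ c₂ c₃ X X Y + cnt c₁ c₂ c₃ Y Y X = n X * n Y := by
  have h1 := h.cnt_add hXY
  have h2 := h.swap₁₂.swap₂₃.cnt_add hXY.symm
  rw [← cnt_swap₂₃ c₂ c₁ c₃ Y Y X, ← cnt_swap₂₃ c₂ c₁ c₃ Y X X, ← cnt_swap₁₂ c₁ c₂ c₃ Y Y X,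
    ← cnt_swap₁₂ c₁ c₂ c₃ X Y X] at h2
  have h3 := h.cnt_comm hXY
  have h4 := mul_comm (n X) (n Y)
  omega

theorem RF.cnt_sum_le (h : RF n c₁ c₂ c₃) (h4 : Four A B C D) :
    cnt c₁ c₂ c₃ A A B + cnt c₁ c₂ c₃ A A C + cnt c₁ c₂ c₃ A A D ≤ n A * n A := by
  have := sum_fiber_eq h4 (cls c₁ A ×ˢ cls c₂ A) (fun q => c₃ (-(q.1 + q.2)))
  rw [card_product, h.card₁, h.card₂] at this
  unfold cnt
  omega

/-- Pollard's theorem for `(A ∪ B) + C` with cap `n A`. The sums avoid `D`; those landing in `C`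
contribute at most n A · n C, and the rest are solutions of types ACA and BCB, as numerous as AAC
and BBC. -/
theorem RF.pollard (h : RF n c₁ c₂ c₃) (h4 : Four A B C D) (hC : n A ≤ n C) :
    n A * n B ≤ cnt c₁ c₂ c₃ A A C + cnt c₁ c₂ c₃ B B C := by
  have hAB : #(cls c₁ A ∪ cls c₁ B) = n A + n B := by
    rw [card_union_of_disjoint (disjoint_cls _ h4.ab), h.card₁, h.card₁]
  have hsum := h.sum_card h4
  have key := ZModSumset.pollard (n A) (cls c₁ A ∪ cls c₁ B) (cls c₂ C) (by omega)
    (by rw [h.card₂]; exact hC) (by rw [hAB, h.card₂]; omega)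
  rw [hAB, h.card₂] at key
  have hle : ∑ w, min (n A) (rep (cls c₁ A ∪ cls c₁ B) (cls c₂ C) w) ≤
      ∑ w, ((if w ∈ cls (fun w => c₃ (-w)) A ∪ cls (fun w => c₃ (-w)) B then
          rep (cls c₁ A ∪ cls c₁ B) (cls c₂ C) w else 0)
        + (if w ∈ cls (fun w => c₃ (-w)) C then n A else 0)) := by
    refine sum_le_sum fun w _ => ?_
    rcases h4.cover (c₃ (-w)) with hw | hw | hw | hw
    · rw [if_pos (by simp [hw])]; omega
    · rw [if_pos (by simp [hw])]; omega
    · rw [if_pos (show w ∈ cls (fun w => c₃ (-w)) C by simp [hw])]; omega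
    · have : rep (cls c₁ A ∪ cls c₁ B) (cls c₂ C) w = 0 := by
        unfold rep
        rw [card_eq_zero, filter_eq_empty_iff]
        intro x hx hy
        simp only [mem_union, mem_cls] at hx hy
        have h1 : c₁ x ≠ c₂ (w - x) := by
          rw [hy]; rcases hx with hx | hx <;> rw [hx]
          exacts [h4.ac, h4.bc]
        have h2 := h.color_third h1
        rw [show x + (w - x) = w by ring, hw, hy] at h2
        rcases hx with hx | hx <;> rw [hx] at h2
        · exact h2.elim h4.ad.symm h4.cd.symm
        · exact h2.elim h4.bd.symm h4.cd.symm
      rw [this]; omega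
  rw [sum_add_distrib, ← sum_filter, ← sum_filter, sum_const, filter_mem_eq_inter,
    filter_mem_eq_inter, univ_inter, univ_inter, h.card_neg₃, sum_rep, smul_eq_mul] at hle
  have hcnt : #{q ∈ (cls c₁ A ∪ cls c₁ B) ×ˢ cls c₂ C |
      q.1 + q.2 ∈ cls (fun w => c₃ (-w)) A ∪ cls (fun w => c₃ (-w)) B} ≤
      cnt c₁ c₂ c₃ A C A + cnt c₁ c₂ c₃ B C B := by
    refine (card_le_card ?_).trans (card_union_le _ _)
    rintro ⟨x, y⟩ hq
    simp only [mem_filter, mem_product, mem_cls, mem_union] at hq ⊢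
    obtain ⟨⟨hx, hy⟩, hz⟩ := hq
    have h1 : c₁ x ≠ c₂ y := by
      rw [hy]; rcases hx with hx | hx <;> rw [hx]
      exacts [h4.ac, h4.bc]
    have h2 := h.color_third h1
    have := h4.ac
    have := h4.bc
    grind
  rw [h.cnt_comm h4.ac, h.cnt_comm h4.bc] at hcnt
  nlinarith

/-- Summing over the third color gives 3 · n A · n B ≤ (n A)² + (n B)², which fails for equal or
consecutive sizes. -/
theorem RF.card_gap (h : RF n c₁ c₂ c₃) (h4 : Four A B C D) (hA : 1 ≤ n A) (hAB : n A ≤ n B)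
    (hC : n B ≤ n C) (hD : n B ≤ n D) : n A + 2 ≤ n B := by
  have h1 := h.pollard h4 (by omega)
  have h2 := h.pollard h4.swap₃₄ (by omega)
  have h3 := h.cnt_diag_add h4.ab
  have h5 := h.cnt_sum_le h4
  have h6 := h.cnt_sum_le h4.swap₁₂
  by_contra! hc
  obtain e | e : n B = n A ∨ n B = n A + 1 := by omega
  all_goals
    rw [e] at h1 h2 h3 h6
    nlinarith

/-! ### Crossing two translates of the partition -/

/-- The number of `x ∈ S` with `x - τ ∈ S`. -/
def overlap (τ : ZMod p) (S : Finset (ZMod p)) : ℕ := #(S ∩ shift τ S)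

theorem overlap_cls_neg (τ : ZMod p) (c : ZMod p → κ) (X : κ) :
    overlap τ (cls (fun w => c (-w)) X) = overlap τ (cls c X) := by
  refine card_bij (fun x _ => τ - x) ?_ ?_ ?_
  · intro x hx
    simp only [mem_inter, mem_shift, mem_cls] at hx ⊢
    rw [neg_sub] at hx
    rw [sub_sub_cancel_left]
    exact hx.symm
  · intro x _ y _ e
    simpa using e
  · intro y hy
    refine ⟨τ - y, ?_, by ring⟩
    simp only [mem_inter, mem_shift, mem_cls] at hy ⊢
    rw [neg_sub, sub_sub_cancel_left, neg_neg]
    exact hy.symm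

theorem RF.le_overlap (h : RF n c₁ c₂ c₃) {X : κ} (hAX : A ≠ X) {a a' : ZMod p}
    (ha : c₁ a = A) (ha' : c₁ a' = A) : n X ≤ overlap (a - a') (cls c₂ X) + n A := by
  have hsub : shift a (cls c₂ X) ∪ shift a' (cls c₂ X) ⊆
      cls (fun w => c₃ (-w)) A ∪ cls (fun w => c₃ (-w)) X := by
    refine union_subset ?_ ?_
    · intro w hw
      exact h.add_subset hAX (mem_add.2 ⟨a, by simpa, _, mem_shift.1 hw, by ring⟩)
    · intro w hw
      exact h.add_subset hAX (mem_add.2 ⟨a', by simpa, _, mem_shift.1 hw, by ring⟩)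
  have h1 := card_le_card hsub
  rw [card_union_of_disjoint (disjoint_cls _ hAX), h.card_neg₃, h.card_neg₃] at h1
  have h2 := card_union_add_card_inter (shift a (cls c₂ X)) (shift a' (cls c₂ X))
  rw [card_shift, card_shift, h.card₂] at h2
  have h3 : shift a (cls c₂ X) ∩ shift a' (cls c₂ X)
      = shift a' (cls c₂ X ∩ shift (a - a') (cls c₂ X)) := by
    ext w
    simp only [mem_inter, mem_shift]
    rw [show w - a' - (a - a') = w - a by ring, and_comm]
  rw [h3, card_shift] at h2
  unfold overlap
  omega

/-- Since class `A` is not a progression, Vosper gives |A + F| ≥ |A| + |F| for F = X ∩ (X + τ). For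
w in A + F both w and w - τ get colors from {A, X}, so A + F is covered by four kinds of points.
Over X = B, C, D the two mixed kinds total 2(n A - overlap of A). -/
theorem RF.overlap_sum_le (h : RF n c₁ c₂ c₃) (h4 : Four A B C D) (hA : 2 ≤ n A)
    (hB : n A + 2 ≤ n B) (hC : n A + 2 ≤ n C) (hD : n A + 2 ≤ n D)
    (harc : ∀ d ≠ 0, ¬ IsArc d (cls c₁ A)) {a a' : ZMod p} (ha : c₁ a = A) (ha' : c₁ a' = A) :
    overlap (a - a') (cls c₂ B) + overlap (a - a') (cls c₂ C) + overlap (a - a') (cls c₂ D) + n A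
      ≤ overlap (a - a') (cls c₃ A) + (overlap (a - a') (cls c₃ B)
        + overlap (a - a') (cls c₃ C) + overlap (a - a') (cls c₃ D)) := by
  have hsum := h.sum_card h4
  set τ := a - a'
  rw [← overlap_cls_neg τ c₃, ← overlap_cls_neg τ c₃, ← overlap_cls_neg τ c₃,
    ← overlap_cls_neg τ c₃]
  set c' := fun w => c₃ (-w)
  have hA' : #(cls c' A) = n A := h.card_neg₃ A
  have key : ∀ X, A ≠ X → n A + 2 ≤ n X → n A + n X + 2 ≤ p → overlap τ (cls c₂ X) + n A ≤
      overlap τ (cls c' X) + #{w ∈ cls c' A | c' (w - τ) = X}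
        + #{w ∈ shift τ (cls c' A) | c' w = X} + overlap τ (cls c' A) := by
    intro X hAX hX hp
    have hT : #(cls c' A ∪ cls c' X) = n A + n X := by
      rw [card_union_of_disjoint (disjoint_cls _ hAX), h.card_neg₃, h.card_neg₃]
    have hov : n X ≤ overlap τ (cls c₂ X) + n A := h.le_overlap hAX ha ha'
    have h1 := card_add_card_le_of_not_isArc (S := cls c₁ A)
      (F := cls c₂ X ∩ shift τ (cls c₂ X)) (by rw [h.card₁]; exact hA) harc
      (by unfold overlap at hov; omega) (T := cls c' A ∪ cls c' X)
      ((add_subset_add_left inter_subset_left).trans (h.add_subset hAX)) (by omega)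
    rw [h.card₁] at h1
    have h2 : cls c₁ A + (cls c₂ X ∩ shift τ (cls c₂ X)) ⊆
        ((cls c' X ∩ shift τ (cls c' X)) ∪ {w ∈ cls c' A | c' (w - τ) = X})
        ∪ {w ∈ shift τ (cls c' A) | c' w = X} ∪ (cls c' A ∩ shift τ (cls c' A)) := by
      intro w hw
      obtain ⟨x, hx, y, hy, rfl⟩ := mem_add.1 hw
      rw [mem_inter, mem_shift] at hy
      have k1 := h.add_subset hAX (add_mem_add hx hy.1)
      have k2 := h.add_subset hAX (add_mem_add hx hy.2)
      rw [show x + (y - τ) = x + y - τ by ring] at k2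
      simp only [mem_union, mem_inter, mem_shift, mem_filter, mem_cls] at k1 k2 ⊢
      tauto
    have h3 := card_le_card h2
    have h5 := (card_union_le _ _).trans (Nat.add_le_add_right ((card_union_le _ _).trans
      (Nat.add_le_add_right (card_union_le (cls c' X ∩ shift τ (cls c' X))
        {w ∈ cls c' A | c' (w - τ) = X}) #{w ∈ shift τ (cls c' A) | c' w = X}))
        #(cls c' A ∩ shift τ (cls c' A)))
    unfold overlap
    omega
  have s1 := sum_fiber_eq h4 (cls c' A) (fun w => c' (w - τ))
  have s2 := sum_fiber_eq h4 (shift τ (cls c' A)) c'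
  rw [card_shift] at s2
  have o1 : #{w ∈ cls c' A | c' (w - τ) = A} = overlap τ (cls c' A) := by
    unfold overlap; congr 1; ext w; simp
  have o2 : #{w ∈ shift τ (cls c' A) | c' w = A} = overlap τ (cls c' A) := by
    unfold overlap; congr 1; ext w; simp [and_comm]
  have kB := key B h4.ab hB (by omega)
  have kC := key C h4.ac hC (by omega)
  have kD := key D h4.ad hD (by omega)
  omega

/-- Adding `RF.overlap_sum_le` to its mirror image in `c₂`, `c₃` cancels the overlaps of `B`, `C`,
`D`. What remains bounds 2 · n A by two overlaps of class `A`, each less than `n A`. -/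
theorem RF.exists_isArc (h : RF n c₁ c₂ c₃) (h4 : Four A B C D) (hA : 2 ≤ n A)
    (hB : n A + 2 ≤ n B) (hC : n A + 2 ≤ n C) (hD : n A + 2 ≤ n D) :
    ∃ d ≠ 0, IsArc d (cls c₁ A) := by
  by_contra! harc
  have hsum := h.sum_card h4
  obtain ⟨a, ha, a', ha', hne⟩ := one_lt_card.1 (show 1 < #(cls c₁ A) by rw [h.card₁]; omega)
  simp only [mem_cls] at ha ha'
  have h1 := h.overlap_sum_le h4 hA hB hC hD harc ha ha'
  have h2 := h.swap₂₃.overlap_sum_le h4 hA hB hC hD harc ha ha'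
  have key : ∀ c : ZMod p → κ, #(cls c A) = n A → overlap (a - a') (cls c A) < n A := by
    intro c hc
    rw [← hc]
    refine shift_inter_ssubset (card_pos.1 (by omega)) ?_ (sub_ne_zero.2 hne)
    intro hu
    rw [hu, card_univ, ZMod.card] at hc
    omega
  have := key c₂ (h.card₂ A)
  have := key c₃ (h.card₃ A)
  omega

end RainbowFree

/-! ### Color classes that are arithmetic progressions. -/

namespace RainbowFree

open Finset ZModSumset
open scoped Pointwise

set_option linter.unusedSectionVars false

variable {p : ℕ} [Fact p.Prime] {κ : Type*} [DecidableEq κ]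
variable {n : κ → ℕ} {c₁ c₂ c₃ : ZMod p → κ} {A B C D : κ}

theorem natCast_mul_inj {d : ZMod p} (hd : d ≠ 0) {i j : ℕ} (hi : i < p) (hj : j < p)
    (h : (i : ZMod p) * d = j * d) : i = j := by
  have := (ZMod.natCast_eq_natCast_iff' _ _ _).1 (mul_right_cancel₀ hd h)
  rwa [Nat.mod_eq_of_lt hi, Nat.mod_eq_of_lt hj] at this

theorem RF.color_of_two (h : RF n c₁ c₂ c₃) {X : κ} {u v x x' : ZMod p} (hu : c₂ u ≠ X)
    (hv : c₂ v ≠ X) (huv : c₂ u ≠ c₂ v) (hx : c₁ x = X) (hx' : c₁ x' = X) (e : u + x = v + x') :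
    c₃ (-(u + x)) = X := by
  have h1 := h.color_third (x := x) (y := u) (by rw [hx]; exact hu.symm)
  have h2 := h.color_third (x := x') (y := v) (by rw [hx']; exact hv.symm)
  rw [add_comm, hx] at h1
  rw [add_comm, ← e, hx'] at h2
  rcases h1 with h1 | h1
  · exact h1
  · rcases h2 with h2 | h2
    · exact h2
    · exact absurd (h1.symm.trans h2) huv

/-- As m + k < n X, every term of the progression can move m steps forward or k steps back inside
it. So `y + x` has a second representation through a neighbor of another color, and
`RF.color_of_two` applies; equal sizes turn inclusion into equality. -/
theorem RF.window (h : RF n c₁ c₂ c₃) {X : κ} {e d : ZMod p}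
    (hAP : ∀ x, c₁ x = X ↔ ∃ i < n X, x = e + (i : ℕ) * d) {y : ZMod p} {m k : ℕ}
    (hmk : m + k < n X) (hy : c₂ y ≠ X) (h1 : c₂ (y - m * d) ≠ X) (h1' : c₂ y ≠ c₂ (y - m * d))
    (h2 : c₂ (y + k * d) ≠ X) (h2' : c₂ y ≠ c₂ (y + k * d)) (z : ZMod p) :
    c₃ z = X ↔ ∃ x, c₁ x = X ∧ z = -(y + x) := by
  have key : ∀ x, c₁ x = X → c₃ (-(y + x)) = X := by
    intro x hx
    obtain ⟨i, hi, rfl⟩ := (hAP x).1 hx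
    rcases Nat.lt_or_ge (i + m) (n X) with him | him
    · refine h.color_of_two (v := y - m * d) (x' := e + ((i + m : ℕ) : ZMod p) * d) hy h1 h1' hx
        ((hAP _).2 ⟨_, him, rfl⟩) ?_
      push_cast; ring
    · refine h.color_of_two (v := y + k * d) (x' := e + ((i - k : ℕ) : ZMod p) * d) hy h2 h2' hx
        ((hAP _).2 ⟨_, by omega, rfl⟩) ?_
      rw [Nat.cast_sub (by omega)]; ring
  have himg : (cls c₁ X).image (fun x => -(y + x)) = cls c₃ X := by
    refine eq_of_subset_of_card_le ?_ ?_
    · intro z hz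
      obtain ⟨x, hx, rfl⟩ := mem_image.1 hz
      exact mem_cls.2 (key x (mem_cls.1 hx))
    · rw [card_image_of_injective _ (fun a b hab => by simpa using hab), h.card₁, h.card₃]
  rw [← mem_cls, ← himg, mem_image]
  simp only [mem_cls, eq_comm]

/-- By Cauchy–Davenport each of X + P, X + Q, X + R misses at most one element of the negated class
`X` of `c₃`. As n X ≥ 4, some `w` lies in all three, so a window of n X consecutive points contains
all three other colors; the middle one is the `y` of `RF.window`. -/
theorem RF.exists_dual (h : RF n c₁ c₂ c₃) {X P Q R : κ} (h4 : Four X P Q R) (hX : 4 ≤ n X)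
    (hP : 1 ≤ n P) (hQ : 1 ≤ n Q) (hR : 1 ≤ n R) {e d : ZMod p}
    (hAP : ∀ x, c₁ x = X ↔ ∃ i < n X, x = e + (i : ℕ) * d) :
    ∃ y, c₂ y ≠ X ∧ ∀ z, c₃ z = X ↔ ∃ x, c₁ x = X ∧ z = -(y + x) := by
  have hsum := h.sum_card h4
  set c' := fun w => c₃ (-w)
  have hc' : ∀ Y, #(cls c' Y) = n Y := h.card_neg₃
  have miss : ∀ Y, X ≠ Y → 1 ≤ n Y → n X + n Y < p →
      #(cls c' X \ (cls c₁ X + cls c₂ Y)) ≤ 1 := by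
    intro Y hXY hY hp
    have hsub := h.add_subset hXY
    have h0 := card_le_card hsub
    rw [card_union_of_disjoint (disjoint_cls _ hXY), h.card_neg₃, h.card_neg₃] at h0
    have h1 := card_add_ge (S := cls c₁ X) (T := cls c₂ Y)
      (card_pos.1 (by rw [h.card₁]; omega)) (card_pos.1 (by rw [h.card₂]; omega)) (by omega)
    rw [h.card₁, h.card₂] at h1
    have h2 : #((cls c₁ X + cls c₂ Y) \ cls c' X) ≤ n Y := by
      rw [← hc' Y]
      refine card_le_card fun w hw => ?_
      have := hsub (mem_sdiff.1 hw).1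
      have := (mem_sdiff.1 hw).2
      simp only [mem_union, c'] at *
      tauto
    have h3 := card_sdiff_add_card_inter (cls c₁ X + cls c₂ Y) (cls c' X)
    have h4 := card_sdiff_add_card_inter (cls c' X) (cls c₁ X + cls c₂ Y)
    rw [inter_comm, hc'] at h4
    omega
  have mP := miss P h4.ab hP (by omega)
  have mQ := miss Q h4.ac hQ (by omega)
  have mR := miss R h4.ad hR (by omega)
  obtain ⟨w, hw, hw'⟩ : ∃ w ∈ cls c' X, w ∉ (cls c' X \ (cls c₁ X + cls c₂ P))
      ∪ (cls c' X \ (cls c₁ X + cls c₂ Q)) ∪ (cls c' X \ (cls c₁ X + cls c₂ R)) := by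
    apply exists_mem_notMem_of_card_lt_card
    have := card_union_le ((cls c' X \ (cls c₁ X + cls c₂ P))
      ∪ (cls c' X \ (cls c₁ X + cls c₂ Q))) (cls c' X \ (cls c₁ X + cls c₂ R))
    have := card_union_le (cls c' X \ (cls c₁ X + cls c₂ P))
      (cls c' X \ (cls c₁ X + cls c₂ Q))
    rw [hc']
    omega
  have hrep : ∀ Y, w ∉ cls c' X \ (cls c₁ X + cls c₂ Y) →
      ∃ i < n X, c₂ (w - e - (i : ℕ) * d) = Y := by
    intro Y hY
    rw [mem_sdiff, not_and, not_not] at hY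
    obtain ⟨x, hx, y, hy, e1⟩ := mem_add.1 (hY hw)
    obtain ⟨i, hi, rfl⟩ := (hAP x).1 (mem_cls.1 hx)
    refine ⟨i, hi, ?_⟩
    rw [← e1, show e + i * d + y - e - i * d = y by ring]
    exact mem_cls.1 hy
  simp only [mem_union, not_or] at hw'
  obtain ⟨i, hi, eP⟩ := hrep P hw'.1.1
  obtain ⟨j, hj, eQ⟩ := hrep Q hw'.1.2
  obtain ⟨k, hk, eR⟩ := hrep R hw'.2
  have fin : ∀ i j k : ℕ, i < j → j < k → k < n X → c₂ (w - e - i * d) ≠ X →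
      c₂ (w - e - j * d) ≠ X → c₂ (w - e - k * d) ≠ X →
      c₂ (w - e - j * d) ≠ c₂ (w - e - i * d) → c₂ (w - e - j * d) ≠ c₂ (w - e - k * d) →
      ∃ y, c₂ y ≠ X ∧ ∀ z, c₃ z = X ↔ ∃ x, c₁ x = X ∧ z = -(y + x) := by
    intro i j k hij hjk hk a1 a2 a3 a4 a5
    have e1 : w - e - j * d - ((k - j : ℕ) : ZMod p) * d = w - e - k * d := by
      rw [Nat.cast_sub hjk.le]; ring
    have e2 : w - e - j * d + ((j - i : ℕ) : ZMod p) * d = w - e - i * d := by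
      rw [Nat.cast_sub hij.le]; ring
    exact ⟨_, a2, h.window hAP (m := k - j) (k := j - i) (by omega) a2 (by rwa [e1])
      (by rwa [e1]) (by rwa [e2]) (by rwa [e2])⟩
  have nPQ := h4.bc
  have nPR := h4.bd
  have nQR := h4.cd
  have nP := h4.ab.symm
  have nQ := h4.ac.symm
  have nR := h4.ad.symm
  have hij : i ≠ j := by rintro rfl; exact nPQ (eP.symm.trans eQ)
  have hik : i ≠ k := by rintro rfl; exact nPR (eP.symm.trans eR)
  have hjk : j ≠ k := by rintro rfl; exact nQR (eQ.symm.trans eR)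
  rcases lt_or_gt_of_ne hij with l1 | l1 <;> rcases lt_or_gt_of_ne hik with l2 | l2 <;>
    rcases lt_or_gt_of_ne hjk with l3 | l3
  · exact fin i j k (by assumption) (by assumption) (by assumption) (by simpa only [eP, eQ, eR])
      (by simpa only [eP, eQ, eR]) (by simpa only [eP, eQ, eR])
      (by simpa only [eP, eQ, eR, ne_comm]) (by simpa only [eP, eQ, eR, ne_comm])
  · exact fin i k j (by assumption) (by assumption) (by assumption) (by simpa only [eP, eQ, eR])
      (by simpa only [eP, eQ, eR]) (by simpa only [eP, eQ, eR])
      (by simpa only [eP, eQ, eR, ne_comm]) (by simpa only [eP, eQ, eR, ne_comm])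
  · omega
  · exact fin k i j (by assumption) (by assumption) (by assumption) (by simpa only [eP, eQ, eR])
      (by simpa only [eP, eQ, eR]) (by simpa only [eP, eQ, eR])
      (by simpa only [eP, eQ, eR, ne_comm]) (by simpa only [eP, eQ, eR, ne_comm])
  · exact fin j i k (by assumption) (by assumption) (by assumption) (by simpa only [eP, eQ, eR])
      (by simpa only [eP, eQ, eR]) (by simpa only [eP, eQ, eR])
      (by simpa only [eP, eQ, eR, ne_comm]) (by simpa only [eP, eQ, eR, ne_comm])
  · omega
  · exact fin j k i (by assumption) (by assumption) (by assumption) (by simpa only [eP, eQ, eR])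
      (by simpa only [eP, eQ, eR]) (by simpa only [eP, eQ, eR])
      (by simpa only [eP, eQ, eR, ne_comm]) (by simpa only [eP, eQ, eR, ne_comm])
  · exact fin k j i (by assumption) (by assumption) (by assumption) (by simpa only [eP, eQ, eR])
      (by simpa only [eP, eQ, eR]) (by simpa only [eP, eQ, eR])
      (by simpa only [eP, eQ, eR, ne_comm]) (by simpa only [eP, eQ, eR, ne_comm])

/-- In a rainbow-free coloring with four colors, no large color class is an arithmetic
progression. -/
theorem RF.not_isArc (h : RF n c₁ c₂ c₃) {X P Q R : κ} (h4 : Four X P Q R) (hX : 4 ≤ n X)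
    (hP : 2 ≤ n P) (hQ : 2 ≤ n Q) (hR : 2 ≤ n R) {d : ZMod p} (hd : d ≠ 0)
    (harc : IsArc d (cls c₁ X)) : False := by
  have hsum := h.sum_card h4
  obtain ⟨e, he⟩ := harc.eq_image (card_pos.1 (by rw [h.card₁]; omega)) (by
    intro hu
    have h1 := h.card₁ X
    rw [hu, card_univ, ZMod.card] at h1
    omega) hd
  rw [h.card₁] at he
  have hAP : ∀ x, c₁ x = X ↔ ∃ i < n X, x = e + (i : ℕ) * d := by
    intro x
    rw [← mem_cls, he]
    simp only [mem_image, mem_range, eq_comm]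
  obtain ⟨y, hy, hy3⟩ := h.exists_dual h4 hX (by omega) (by omega) (by omega) hAP
  obtain ⟨z, -, hz2⟩ := h.swap₂₃.exists_dual h4 hX (by omega) (by omega) (by omega) hAP
  -- Coordinates along `d` in which class `X` of `c₂` fills the last n X indices.
  set s := -(z + e) + d with hs
  have hpos : ∀ v, ∃ i < p, v = s + (i : ℕ) * d := by
    intro v
    refine ⟨((v - s) / d).val, ZMod.val_lt _, ?_⟩
    rw [ZMod.natCast_zmod_val, div_mul_cancel₀ _ hd]; ring
  have hinj : ∀ i j : ℕ, i < p → j < p → s + i * d = s + j * d → i = j :=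
    fun i j hi hj e => natCast_mul_inj hd hi hj (add_left_cancel e)
  have hcol : ∀ i : ℕ, i < p → (c₂ (s + i * d) = X ↔ p - n X ≤ i) := by
    intro i hi
    rw [hz2]
    constructor
    · rintro ⟨x, hx, e1⟩
      obtain ⟨k, hk, rfl⟩ := (hAP x).1 hx
      by_contra! hlt
      have := natCast_mul_inj (i := i + 1 + k) (j := 0) hd (by omega) (by omega) (by
        push_cast
        linear_combination e1)
      omega
    · intro hle
      refine ⟨_, (hAP _).2 ⟨p - 1 - i, by omega, rfl⟩, ?_⟩
      have : ((p - 1 - i : ℕ) : ZMod p) = -1 - i := by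
        rw [Nat.cast_sub (by omega), Nat.cast_sub (by omega)]; simp
      rw [this, hs]; ring
  obtain ⟨t, htp, hyt⟩ := hpos y
  have ht : t < p - n X := by
    by_contra! hc
    exact hy (by rw [hyt]; exact (hcol t htp).2 hc)
  -- A color change forces n X - 1 consecutive terms into the n X terms of the dual progression at
  -- `y`. Only two positions are possible, so colors change only next to the index `t` of `y`.
  have hstep : ∀ i : ℕ, i + 1 < p - n X → c₂ (s + i * d) ≠ c₂ (s + (i + 1 : ℕ) * d) →
      i + 1 = t ∨ i = t := by
    intro i hi hne
    have n1 : c₂ (s + i * d) ≠ X := fun hc => by have := (hcol i (by omega)).1 hc; omega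
    have n2 : c₂ (s + (i + 1 : ℕ) * d) ≠ X := fun hc => by
      have := (hcol (i + 1) (by omega)).1 hc; omega
    have hk : ∀ m : ℕ, m + 1 < n X → ∃ k < n X, s + (i + 1 : ℕ) * d + m * d = y + (k : ℕ) * d := by
      intro m hm
      have h1 := h.color_of_two (u := s + (i + 1 : ℕ) * d) (v := s + i * d) (x := e + m * d)
        (x' := e + (m + 1 : ℕ) * d) n2 n1 hne.symm ((hAP _).2 ⟨m, by omega, rfl⟩)
        ((hAP _).2 ⟨m + 1, by omega, rfl⟩) (by push_cast; ring)
      obtain ⟨x, hx, e1⟩ := (hy3 _).1 h1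
      obtain ⟨k, hk, rfl⟩ := (hAP x).1 hx
      exact ⟨k, hk, by linear_combination -e1⟩
    obtain ⟨k, hk0, ek⟩ := hk 0 (by omega)
    have hk1 : k ≤ 1 := by
      by_contra! hk2
      obtain ⟨k', hk0', ek'⟩ := hk (n X - k) (by omega)
      have := natCast_mul_inj (i := n X) (j := k') hd (by omega) (by omega) (by
        rw [Nat.cast_sub hk0.le] at ek'
        linear_combination ek' - ek)
      omega
    rcases (show k = 0 ∨ k = 1 by omega) with rfl | rfl
    · left
      refine hinj _ _ (by omega) htp ?_
      rw [← hyt]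
      linear_combination ek
    · right
      refine hinj _ _ (by omega) htp ?_
      rw [← hyt]
      push_cast at ek
      linear_combination ek
  have hlow : ∀ j i : ℕ, i ≤ j → j < t → c₂ (s + i * d) = c₂ (s + j * d) := by
    intro j
    induction j with
    | zero => intro i hi _; rw [Nat.le_zero.1 hi]
    | succ j ih =>
      intro i hi hj
      rcases Nat.lt_or_ge i (j + 1) with hij | hij
      · rw [ih i (by omega) (by omega)]
        by_contra hne
        have := hstep j (by omega) hne
        omega
      · rw [show i = j + 1 by omega]
  have hhigh : ∀ j i : ℕ, t < i → i ≤ j → j < p - n X → c₂ (s + i * d) = c₂ (s + j * d) := by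
    intro j
    induction j with
    | zero => intro i _ hi _; rw [Nat.le_zero.1 hi]
    | succ j ih =>
      intro i hti hi hj
      rcases Nat.lt_or_ge i (j + 1) with hij | hij
      · rw [ih i hti (by omega) (by omega)]
        by_contra hne
        have := hstep j (by omega) hne
        omega
      · rw [show i = j + 1 by omega]
  have hlow' : ∀ i j : ℕ, i < t → j < t → c₂ (s + i * d) = c₂ (s + j * d) := by
    intro i j hi hj
    rcases le_total i j with hij | hij
    exacts [hlow j i hij hj, (hlow i j hij hi).symm]
  have hhigh' : ∀ i j : ℕ, t < i → t < j → i < p - n X → j < p - n X →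
      c₂ (s + i * d) = c₂ (s + j * d) := by
    intro i j hi hj hi' hj'
    rcases le_total i j with hij | hij
    exacts [hhigh j i hi hij hj', (hhigh i j hj hij hi').symm]
  -- Each of the three colors has a point other than `y`, but only two constant stretches, below and
  -- above `t`, are available.
  have hex : ∀ Y, Y ≠ X → 2 ≤ n Y → ∃ i : ℕ, i ≠ t ∧ i < p - n X ∧ c₂ (s + i * d) = Y := by
    intro Y hYX hY
    obtain ⟨q, hq, hqy⟩ := exists_mem_ne (s := cls c₂ Y) (by rw [h.card₂]; omega) y
    obtain ⟨i, hi, rfl⟩ := hpos q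
    refine ⟨i, ?_, ?_, mem_cls.1 hq⟩
    · rintro rfl; exact hqy hyt.symm
    · by_contra! hc
      exact hYX ((mem_cls.1 hq).symm.trans ((hcol i hi).2 hc))
  obtain ⟨i, hi, hi', ei⟩ := hex P h4.ab.symm hP
  obtain ⟨j, hj, hj', ej⟩ := hex Q h4.ac.symm hQ
  obtain ⟨k, hk, hk', ek⟩ := hex R h4.ad.symm hR
  have side : ∀ i j : ℕ, c₂ (s + i * d) ≠ c₂ (s + j * d) → i < p - n X → j < p - n X →
      ¬ (i < t ∧ j < t) ∧ ¬ (t < i ∧ t < j) :=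
    fun i j hne hi hj =>
      ⟨fun l => hne (hlow' i j l.1 l.2), fun l => hne (hhigh' i j l.1 l.2 hi hj)⟩
  have b1 := side i j (by rw [ei, ej]; exact h4.bc) hi' hj'
  have b2 := side i k (by rw [ei, ek]; exact h4.bd) hi' hk'
  have b3 := side j k (by rw [ej, ek]; exact h4.cd) hj' hk'
  omega

end RainbowFree

/-! ### Impossibility of four colors. -/

namespace RainbowFree

open Finset ZModSumset
open scoped Pointwise

set_option linter.unusedSectionVars false

variable {p : ℕ} [Fact p.Prime] {κ : Type*} [DecidableEq κ]
variable {n : κ → ℕ} {c₁ c₂ c₃ : ZMod p → κ} {A B C D : κ}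

theorem RF.exists_good (h : RF n c₁ c₂ c₃) {X Y Z : κ} (h4 : Four A X Y Z) (hA : 2 ≤ n A)
    (hX : 4 ≤ n X) (hY : 4 ≤ n Y) (hZ : 4 ≤ n Z) {t : ZMod p} (ht : c₁ t = A) :
    ∃ y, c₂ y = Y ∧ c₃ (-(t + y)) = A := by
  by_contra! hc
  obtain ⟨d, hd, harc⟩ :=
    (h.critical_insert h4 (by omega) (by omega) (by omega) (by omega) ht hc).symm.exists_isArc
  exact h.swap₁₂.not_isArc h4.swap₂₃.swap₁₂ hY hA (by omega) (by omega) hd harc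

theorem RF.false_of_sorted (h : RF n c₁ c₂ c₃) (h4 : Four A B C D) (hA : 1 ≤ n A)
    (hAB : n A ≤ n B) (hC : n B ≤ n C) (hD : n B ≤ n D) : False := by
  have hgap := h.card_gap h4 hA hAB hC hD
  have hsum := h.sum_card h4
  obtain ⟨t, ht⟩ : (cls c₁ A).Nonempty := card_pos.1 (by rw [h.card₁]; omega)
  replace ht := mem_cls.1 ht
  rcases (show n A = 1 ∨ 2 ≤ n A by omega) with h1 | h2
  -- With one point in class `A`, the third entry and hence `y` is determined, so at most one color
  -- is good; `RF.two_bad` makes at least two of `B`, `C`, `D` good.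
  · have huniq : ∀ y y', c₃ (-(t + y)) = A → c₃ (-(t + y')) = A → y = y' := by
      intro y y' e e'
      have := card_le_one.1 (show #(cls c₃ A) ≤ 1 by rw [h.card₃]; omega) _ (mem_cls.2 e) _
        (mem_cls.2 e')
      simpa using this
    have hgood : ∀ {P Q R}, Four A P Q R → 2 ≤ n P → 2 ≤ n Q → 2 ≤ n R →
        (∃ y, c₂ y = P ∧ c₃ (-(t + y)) = A) ∨ ∃ y, c₂ y = Q ∧ c₃ (-(t + y)) = A := by
      intro P Q R h4 hP hQ hR
      by_contra! hc
      exact h.two_bad h4 hA hP hQ hR ht hc.1 hc.2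
    have g1 := hgood h4 (by omega) (by omega) (by omega)
    have g2 := hgood h4.swap₃₄ (by omega) (by omega) (by omega)
    have g3 := hgood h4.swap₂₃.swap₃₄ (by omega) (by omega) (by omega)
    have hdis : ∀ {P Q}, P ≠ Q → (∃ y, c₂ y = P ∧ c₃ (-(t + y)) = A) →
        (∃ y, c₂ y = Q ∧ c₃ (-(t + y)) = A) → False := by
      rintro P Q hPQ ⟨y, rfl, hy⟩ ⟨y', rfl, hy'⟩
      exact hPQ (by rw [huniq y y' hy hy'])
    rcases g1 with gB | gC
    · rcases g3 with gC | gD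
      exacts [hdis h4.bc gB gC, hdis h4.bd gB gD]
    · rcases g2 with gB | gD
      exacts [hdis h4.bc gB gC, hdis h4.cd gC gD]
  · obtain ⟨d, hd, harc⟩ := h.exists_isArc h4 h2 hgap (by omega) (by omega)
    rcases (show 4 ≤ n A ∨ n A ≤ 3 by omega) with h4A | h3
    · exact h.not_isArc h4 h4A (by omega) (by omega) (by omega) hd harc
    obtain ⟨e, he⟩ := harc.eq_image (card_pos.1 (by rw [h.card₁]; omega)) (by
      intro hu
      have h1 := h.card₁ A
      rw [hu, card_univ, ZMod.card] at h1
      omega) hd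
    rw [h.card₁] at he
    have hAP : ∀ x, c₁ x = A ↔ ∃ i < n A, x = e + (i : ℕ) * d := by
      intro x
      rw [← mem_cls, he]
      simp only [mem_image, mem_range, eq_comm]
    have hwin : ∀ w, c₃ (-w) = A → ∀ {X Y Z}, Four A X Y Z → 4 ≤ n X → 4 ≤ n Y → 4 ≤ n Z →
        ∃ i < n A, c₂ (w - e - (i : ℕ) * d) = Y := by
      intro w hw X Y Z h4 hX hY hZ
      obtain ⟨y, hy, hy'⟩ := h.swap₂₃.swap₁₂.swap₂₃.exists_good h4 h2 hX hY hZ hw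
      obtain ⟨i, hi, e1⟩ := (hAP _).1 hy'
      refine ⟨i, hi, ?_⟩
      rw [← hy]
      congr 1
      linear_combination e1
    -- The n A ≤ 3 points `w - e - i * d` carry all of `B`, `C`, `D`, so n A = 3 and their colors
    -- differ. The first two give two representations of `w + d`, whose color is then `A`.
    have hclosed : ∀ w ∈ cls (fun w => c₃ (-w)) A, w + d ∈ cls (fun w => c₃ (-w)) A := by
      intro w hw
      rw [mem_cls] at hw ⊢
      obtain ⟨i, hi, ei⟩ := hwin w hw h4.swap₂₃ (by omega) (by omega) (by omega)
      obtain ⟨j, hj, ej⟩ := hwin w hw h4 (by omega) (by omega) (by omega)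
      obtain ⟨k, hk, ek⟩ := hwin w hw h4.swap₃₄ (by omega) (by omega) (by omega)
      have hij : i ≠ j := by rintro rfl; exact h4.bc (ei.symm.trans ej)
      have hik : i ≠ k := by rintro rfl; exact h4.bd (ei.symm.trans ek)
      have hjk : j ≠ k := by rintro rfl; exact h4.cd (ej.symm.trans ek)
      have hcol : ∀ m : ℕ, m < 3 → c₂ (w - e - m * d) ≠ A ∧
          ∀ m' < 3, m' ≠ m → c₂ (w - e - m * d) ≠ c₂ (w - e - (m' : ℕ) * d) := by
        have h3' : ∀ m : ℕ, m < 3 → m = i ∨ m = j ∨ m = k := by omega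
        intro m hm
        have := h4.ab
        have := h4.ac
        have := h4.ad
        have := h4.bc
        have := h4.bd
        have := h4.cd
        refine ⟨?_, fun m' hm' hne => ?_⟩
        · rcases h3' m hm with rfl | rfl | rfl <;> simp_all [eq_comm]
        · rcases h3' m hm with rfl | rfl | rfl <;> rcases h3' m' hm' with rfl | rfl | rfl <;>
            simp_all [eq_comm]
      have h0 := hcol 0 (by omega)
      have h1 := hcol 1 (by omega)
      have := h.color_of_two (x := e + (1 : ℕ) * d) (x' := e + (2 : ℕ) * d) h0.1 h1.1
        (h0.2 1 (by omega) (by omega)) ((hAP _).2 ⟨1, by omega, rfl⟩)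
        ((hAP _).2 ⟨2, by omega, rfl⟩) (by push_cast; ring)
      rw [← this]
      congr 2
      push_cast
      ring
    have hne : (cls (fun w => c₃ (-w)) A).Nonempty := card_pos.1 (by rw [h.card_neg₃]; omega)
    have hu := h.card_neg₃ A
    rw [eq_univ_of_add_closed hne hd hclosed, card_univ, ZMod.card] at hu
    omega

/-- There is no rainbow-free triple of colorings of `ℤ/pℤ` with four colors. -/
theorem RF.false_of_four (h : RF n c₁ c₂ c₃) (h4 : Four A B C D) (hn : ∀ X, 1 ≤ n X) : False := by
  have step : ∀ {A B C D}, Four A B C D → n A ≤ n B → n A ≤ n C → n A ≤ n D → False := by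
    intro A B C D h4 hB hC hD
    rcases le_total (n B) (n C) with h1 | h1 <;> rcases le_total (n B) (n D) with h2 | h2 <;>
      rcases le_total (n C) (n D) with h3 | h3
    · exact h.false_of_sorted h4 (hn A) hB h1 h2
    · exact h.false_of_sorted h4 (hn A) hB h1 h2
    · exact h.false_of_sorted h4.swap₃₄.swap₂₃ (hn A) hD h2 (h1.trans' h2)
    · exact h.false_of_sorted h4.swap₃₄.swap₂₃ (hn A) hD h2 h3
    · exact h.false_of_sorted h4.swap₂₃ (hn A) hC h1 h3
    · exact h.false_of_sorted h4.swap₂₃ (hn A) hC h1 (h1.trans h2)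
    · exact h.false_of_sorted h4.swap₂₃ (hn A) hC h1 h3
    · exact h.false_of_sorted h4.swap₃₄.swap₂₃ (hn A) hD h2 h3
  rcases le_total (n A) (n B) with h1 | h1 <;> rcases le_total (n C) (n D) with h2 | h2
  · rcases le_total (n A) (n C) with h3 | h3
    · exact step h4 h1 h3 (h3.trans h2)
    · exact step h4.swap₂₃.swap₁₂ h3 (h3.trans h1) h2
  · rcases le_total (n A) (n D) with h3 | h3
    · exact step h4 h1 (h3.trans h2) h3
    · exact step h4.swap₃₄.swap₂₃.swap₁₂ h3 (h3.trans h1) h2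
  · rcases le_total (n B) (n C) with h3 | h3
    · exact step h4.swap₁₂ h1 h3 (h3.trans h2)
    · exact step h4.swap₂₃.swap₁₂ (h3.trans h1) h3 h2
  · rcases le_total (n B) (n D) with h3 | h3
    · exact step h4.swap₁₂ h1 (h3.trans h2) h3
    · exact step h4.swap₃₄.swap₂₃.swap₁₂ (h3.trans h1) h3 h2

/-- A linear equation with nonzero coefficients gives a rainbow-free triple of colorings. -/
theorem RF.of_coloring (c : ZMod p → κ) {a₁ a₂ a₃ b : ZMod p} (h₁ : a₁ ≠ 0) (h₂ : a₂ ≠ 0)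
    (h₃ : a₃ ≠ 0) (hc : ∀ x y z, a₁ * x + a₂ * y + a₃ * z = b → c x = c y ∨ c x = c z ∨ c y = c z) :
    RF (fun X => #(cls c X)) (fun x => c (x / a₁)) (fun y => c (y / a₂))
      (fun z => c ((z + b) / a₃)) where
  rf x y z e := hc _ _ _ (by
    rw [mul_div_cancel₀ _ h₁, mul_div_cancel₀ _ h₂, mul_div_cancel₀ _ h₃]
    linear_combination e)
  card₁ X := card_equiv (Equiv.divRight₀ a₁ h₁) (by simp)
  card₂ X := card_equiv (Equiv.divRight₀ a₂ h₂) (by simp)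
  card₃ X := card_equiv ((Equiv.addRight b).trans (Equiv.divRight₀ a₃ h₃)) (by simp)

theorem forcesRainbow_four (a₁ a₂ a₃ b : ℤ) (h₁ : (a₁ : ZMod p) ≠ 0) (h₂ : (a₂ : ZMod p) ≠ 0)
    (h₃ : (a₃ : ZMod p) ≠ 0) : ForcesRainbow p a₁ a₂ a₃ b 4 := by
  intro c hc
  by_contra hno
  have hrf := RF.of_coloring (b := (b : ZMod p)) c h₁ h₂ h₃ (fun x y z e => by
    by_contra! hne
    exact hno ⟨x, y, z, e, hne⟩)
  refine hrf.false_of_four (A := 0) (B := 1) (C := 2) (D := 3) ⟨by decide, by decide, by decide,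
    by decide, by decide, by decide, by decide⟩ fun X => ?_
  obtain ⟨x, hx⟩ := hc X
  exact card_pos.2 ⟨x, mem_cls.2 hx⟩

end RainbowFree

/-! ### Polynomials over 𝔽_p with three values. -/

namespace ThreeValued

open Polynomial

variable {p : ℕ} [Fact p.Prime]

theorem natCast_ne_zero_of_lt {k : ℕ} (h0 : 0 < k) (hk : k < p) : (k : ZMod p) ≠ 0 := by
  rw [Ne, ZMod.natCast_eq_zero_iff]
  exact fun h => absurd (Nat.le_of_dvd h0 h) (by omega)

theorem dvd_of_eval_eq_zero {P : (ZMod p)[X]} (h : ∀ x, P.eval x = 0) :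
    (X ^ p - X : (ZMod p)[X]) ∣ P := by
  have hp := (Fact.out : p.Prime).one_lt
  have hdeg : (X ^ p - X : (ZMod p)[X]).natDegree = p :=
    FiniteField.X_pow_card_sub_X_natDegree_eq _ hp
  have hmon : (X ^ p - X : (ZMod p)[X]).Monic :=
    monic_X_pow_sub (by rw [degree_X]; exact_mod_cast hp)
  rw [← modByMonic_eq_zero_iff_dvd hmon]
  refine eq_zero_of_natDegree_lt_card_of_eval_eq_zero' _ Finset.univ (fun x _ => ?_) ?_
  · have := congrArg (eval x) (modByMonic_add_div P (X ^ p - X))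
    simpa [h x, ZMod.pow_card] using this
  · rw [Finset.card_univ, ZMod.card]
    have := natDegree_modByMonic_lt P hmon (by
      intro h1
      rw [h1, natDegree_one] at hdeg
      omega)
    omega

/-- At a root of multiplicity e the equation reads 3e² = e(e - 1) in lowest order, so p divides 2e +
1; since e ≤ m, this means e = m. -/
theorem eq_pow_of_ode {m : ℕ} (hm : 2 * m + 1 = p) {F : (ZMod p)[X]} (hF : F ≠ 0)
    (hdeg : F.natDegree = m) {r : ZMod p} (hr : F.eval r = 0)
    (hode : 3 * derivative F ^ 2 = F * derivative (derivative F)) :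
    ∃ c, F = (X - C r) ^ m * C c := by
  obtain ⟨G, hG, hGr⟩ := exists_eq_pow_rootMultiplicity_mul_and_not_dvd F hF r
  have he0 : 0 < F.rootMultiplicity r := (rootMultiplicity_pos hF).2 hr
  set e := F.rootMultiplicity r
  have hG0 : G ≠ 0 := by rintro rfl; simp at hGr
  rw [dvd_iff_isRoot, IsRoot.def] at hGr
  set Y : (ZMod p)[X] := X - C r with hY
  have hYm : Y.Monic := monic_X_sub_C r
  have hdegs : e + G.natDegree = m := by
    rw [← hdeg, hG, (hYm.pow e).natDegree_mul' hG0, natDegree_pow, hY, natDegree_X_sub_C, mul_one]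
  have hdY : derivative Y = 1 := by simp [hY]
  have hpow : ∀ K : (ZMod p)[X], Y * derivative (Y ^ e * K)
      = Y ^ e * (C (e : ZMod p) * K + Y * derivative K) := by
    intro K
    obtain ⟨k, hk⟩ : ∃ k, e = k + 1 := ⟨e - 1, by omega⟩
    rw [hk, derivative_mul, derivative_pow, hdY]
    simp only [Nat.add_sub_cancel]
    ring
  set H := C (e : ZMod p) * G + Y * derivative G with hH
  have h1 : Y * derivative F = Y ^ e * H := by rw [hG]; exact hpow G
  have h2 : Y ^ 2 * derivative (derivative F)
      = Y ^ e * (C (e : ZMod p) * H + Y * derivative H - H) := by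
    have h3 := congrArg derivative h1
    rw [derivative_mul, hdY] at h3
    have h4 := hpow H
    rw [← h3] at h4
    linear_combination h4 - h1
  have h3 : (Y ^ e) ^ 2 * (3 * H ^ 2)
      = (Y ^ e) ^ 2 * (G * (C (e : ZMod p) * H + Y * derivative H - H)) := by
    have : 3 * (Y * derivative F) ^ 2 = F * (Y ^ 2 * derivative (derivative F)) := by
      linear_combination Y ^ 2 * hode
    rw [h1, h2] at this
    linear_combination this + Y ^ e * (C (e : ZMod p) * H + Y * derivative H - H) * hG
  have h4 := congrArg (eval r) (mul_left_cancel₀ (pow_ne_zero _ (pow_ne_zero _ hYm.ne_zero)) h3)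
  have hYr : eval r Y = 0 := by simp [hY]
  simp only [hH, eval_mul, eval_add, eval_sub, eval_pow, eval_C, hYr, eval_ofNat, zero_mul,
    add_zero] at h4
  have hek := natCast_ne_zero_of_lt (p := p) he0 (by omega)
  have h5 : ((2 * e + 1 : ℕ) : ZMod p) = 0 := by
    have : (e : ZMod p) * eval r G ^ 2 * (2 * e + 1) = 0 := by linear_combination h4
    push_cast
    exact (mul_eq_zero.1 this).resolve_left (mul_ne_zero hek (pow_ne_zero _ hGr))
  rw [ZMod.natCast_eq_zero_iff] at h5
  have := Nat.le_of_dvd (by omega) h5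
  have hem : e = m := by omega
  rw [natDegree_eq_zero.1 (show G.natDegree = 0 by omega) |>.choose_spec.symm, hem] at hG
  exact ⟨_, hG⟩

/-- A polynomial of degree `(p - 1) / 2` with exactly three values on `ℤ/pℤ` is, up to affine
changes of variables, a power. -/
theorem eq_pow_of_three_values {m : ℕ} (hm : 2 * m + 1 = p) (hp : 5 ≤ p) {f : (ZMod p)[X]}
    (hdeg : f.natDegree = m) {v : Fin 3 → ZMod p} (hv : ∀ x, ∃ i, f.eval x = v i)
    (hv' : ∀ i, ∃ x, f.eval x = v i) : ∃ r s c, f = (X - C r) ^ m * C c + C s := by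
  have h3 : (3 : ZMod p) ≠ 0 := by
    exact_mod_cast natCast_ne_zero_of_lt (p := p) (k := 3) (by omega) (by omega)
  have h2 : (2 : ZMod p) ≠ 0 := by
    exact_mod_cast natCast_ne_zero_of_lt (p := p) (k := 2) (by omega) (by omega)
  -- Centering the values removes the quadratic term of the cubic they satisfy.
  set s := (v 0 + v 1 + v 2) / 3 with hs
  have hs3 : 3 * s = v 0 + v 1 + v 2 := by rw [hs]; field_simp
  set F := f - C s with hFdef
  have hFdeg : F.natDegree = m := by rw [hFdef, natDegree_sub_C, hdeg]
  have hF : F ≠ 0 := by rintro h0; rw [h0, natDegree_zero] at hFdeg; omega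
  have hFv : ∀ x, ∃ i, F.eval x = v i - s := by
    intro x
    obtain ⟨i, hi⟩ := hv x
    exact ⟨i, by simp [hFdef, hi]⟩
  set w := fun i => v i - s with hw
  have hw0 : w 0 + w 1 + w 2 = 0 := by simp only [hw]; linear_combination -hs3
  set e₁ := w 0 * w 1 + w 0 * w 2 + w 1 * w 2
  set e₀ := -(w 0 * w 1 * w 2) with he₀
  have hdvd : (X ^ p - X : (ZMod p)[X]) ∣ F ^ 3 + C e₁ * F + C e₀ := by
    refine dvd_of_eval_eq_zero fun x => ?_
    have : eval x (F ^ 3 + C e₁ * F + C e₀)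
        = (F.eval x - w 0) * (F.eval x - w 1) * (F.eval x - w 2) := by
      simp only [eval_add, eval_mul, eval_pow, eval_C, e₁, e₀]
      linear_combination F.eval x ^ 2 * hw0
    rw [this]
    obtain ⟨i, hi⟩ := hFv x
    rw [hi]
    fin_cases i <;> simp [hw]
  obtain ⟨q, hq⟩ := hdvd
  have hΦdeg : (F ^ 3 + C e₁ * F + C e₀).natDegree = 3 * m := by
    rw [natDegree_add_C, natDegree_add_eq_left_of_natDegree_lt, natDegree_pow, hFdeg]
    refine (natDegree_C_mul_le _ _).trans_lt ?_
    rw [natDegree_pow, hFdeg]; omega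
  have hq0 : q ≠ 0 := by
    rintro rfl
    rw [hq, mul_zero, natDegree_zero] at hΦdeg
    omega
  have hqdeg : q.natDegree + 1 = m := by
    have hp1 := (Fact.out : p.Prime).one_lt
    have hmon : (X ^ p - X : (ZMod p)[X]).Monic :=
      monic_X_pow_sub (by rw [degree_X]; exact_mod_cast hp1)
    rw [hq, hmon.natDegree_mul' hq0, FiniteField.X_pow_card_sub_X_natDegree_eq _ hp1] at hΦdeg
    omega
  have hder : (3 * F ^ 2 + C e₁) * derivative F = -q + (X ^ p - X) * derivative q := by
    have := congrArg derivative hq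
    simp only [derivative_add, derivative_mul, derivative_pow, derivative_C, derivative_sub,
      derivative_X, CharP.cast_eq_zero, map_zero, map_ofNat, Nat.cast_ofNat] at this
    linear_combination this
  -- Eliminating X^p - X between the cubic identity and its derivative bounds the degree of F²G by
  -- 2m - 2, so G = 0.
  set G := 3 * (q * derivative F) - F * derivative q with hG
  have hid : F ^ 2 * G = C e₁ * (F * derivative q - q * derivative F) + C e₀ * derivative q
      - q ^ 2 := by
    rw [hG]
    linear_combination q * hder - derivative q * hq
  have hdF : (derivative F).natDegree ≤ m - 1 := hFdeg ▸ natDegree_derivative_le F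
  have hdq : (derivative q).natDegree ≤ m - 2 := by
    have := natDegree_derivative_le q
    omega
  have hG0 : G = 0 := by
    by_contra hne
    have h1 : (F ^ 2 * G).natDegree = 2 * m + G.natDegree := by
      rw [natDegree_mul (pow_ne_zero _ hF) hne, natDegree_pow, hFdeg]
    have h4 : (C e₁ * (F * derivative q - q * derivative F) + C e₀ * derivative q
        - q ^ 2).natDegree ≤ 2 * m - 2 := by
      have k1 : (F * derivative q).natDegree ≤ 2 * m - 2 := natDegree_mul_le.trans (by omega)
      have k2 : (q * derivative F).natDegree ≤ 2 * m - 2 := natDegree_mul_le.trans (by omega)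
      have k3 : (q ^ 2).natDegree ≤ 2 * m - 2 := natDegree_pow_le.trans (by omega)
      have k4 : (C e₁ * (F * derivative q - q * derivative F)).natDegree ≤ 2 * m - 2 :=
        (natDegree_C_mul_le e₁ _).trans
          ((natDegree_sub_le_of_le k1 k2).trans (max_self (2 * m - 2)).le)
      have k5 : (C e₀ * derivative q).natDegree ≤ 2 * m - 2 :=
        (natDegree_C_mul_le e₀ _).trans (by omega)
      exact (natDegree_sub_le_of_le (natDegree_add_le_of_degree_le k4 k5) k3).trans
        (max_self (2 * m - 2)).le
    rw [← hid] at h4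
    omega
  have hG1 : 3 * (q * derivative F) = F * derivative q := sub_eq_zero.1 hG0
  rw [hG0, mul_zero] at hid
  -- The left side has degree below that of `F`, so both sides vanish: e₀ = 0 and q = 2e₁F'.
  have hkey : 3 * C e₀ * derivative F = F * (q - 2 * C e₁ * derivative F) := by
    refine mul_left_cancel₀ hq0 ?_
    linear_combination -F * hid + (C e₁ * F + C e₀) * hG1
  have hdF0 : derivative F ≠ 0 := by
    intro h0
    have := congrArg (fun P => coeff P (m - 1)) h0
    simp only [coeff_derivative, coeff_zero] at this
    rw [show m - 1 + 1 = m by omega, ← hFdeg, coeff_natDegree] at this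
    refine mul_ne_zero (leadingCoeff_ne_zero.2 hF) ?_ this
    have := natCast_ne_zero_of_lt (p := p) (k := m) (by omega) (by omega)
    rw [hFdeg]
    rw [show m = m - 1 + 1 by omega] at this
    exact_mod_cast this
  have he0 : e₀ = 0 := by
    by_contra hne
    have hl : (3 * C e₀ * derivative F) ≠ 0 := by
      refine mul_ne_zero (mul_ne_zero ?_ (C_ne_zero.2 hne)) hdF0
      exact_mod_cast C_ne_zero.2 h3
    have h4 : (3 * C e₀ * derivative F).natDegree ≤ m - 1 := by
      rw [show (3 : (ZMod p)[X]) * C e₀ = C (3 * e₀) by rw [C_mul]; rfl]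
      exact (natDegree_C_mul_le _ _).trans hdF
    rw [hkey] at hl h4
    rw [natDegree_mul hF (right_ne_zero_of_mul hl)] at h4
    omega
  have hqF : q = 2 * C e₁ * derivative F := by
    rw [he0, C_0, mul_zero, zero_mul] at hkey
    exact sub_eq_zero.1 ((mul_eq_zero.1 hkey.symm).resolve_left hF)
  have he1 : C e₁ ≠ 0 := by
    intro h0
    rw [h0, mul_zero, zero_mul] at hqF
    exact hq0 hqF
  have hode : 3 * derivative F ^ 2 = F * derivative (derivative F) := by
    have h2' : (2 : (ZMod p)[X]) ≠ 0 := by exact_mod_cast C_ne_zero.2 h2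
    refine mul_left_cancel₀ (mul_ne_zero h2' he1) ?_
    have hdq' : derivative q = 2 * C e₁ * derivative (derivative F) := by
      conv_lhs => rw [hqF]
      rw [show (2 : (ZMod p)[X]) * C e₁ = C (2 * e₁) by rw [C_mul]; rfl, derivative_C_mul]
    rw [hdq'] at hG1
    linear_combination hG1 - 3 * derivative F * hqF
  obtain ⟨i, hi⟩ : ∃ i, w i = 0 := by
    rw [he₀, neg_eq_zero, mul_eq_zero, mul_eq_zero] at he0
    rcases he0 with (h | h) | h
    exacts [⟨0, h⟩, ⟨1, h⟩, ⟨2, h⟩]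
  obtain ⟨r, hr⟩ := hv' i
  obtain ⟨c, hc⟩ := eq_pow_of_ode hm hF hFdeg (r := r)
    (by simp only [hFdef, eval_sub, eval_C, hr]; exact hi) hode
  exact ⟨r, s, c, by rw [← hc, hFdef]; ring⟩

end ThreeValued

/-! ### Color classes in the group algebra 𝔽_p[ℤ/pℤ]. -/

namespace RainbowFree

open Finset ZModSumset
open scoped Pointwise

set_option linter.unusedSectionVars false

variable {p : ℕ} [Fact p.Prime] {κ : Type*} [DecidableEq κ]

section GroupAlgebra

variable {n : κ → ℕ} {c₁ c₂ c₃ : ZMod p → κ} {A B : κ}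

theorem RF.rep_add_rep (h : RF n c₁ c₂ c₃) (hAB : A ≠ B) {w : ZMod p} (hw : c₁ (-w) = A) :
    rep (cls c₂ B) (cls c₃ A) w + rep (cls c₂ B) (cls c₃ B) w = n B := by
  rw [← rep_union_right (disjoint_cls c₃ hAB), ← h.card₂ B, rep, filter_true_of_mem]
  intro y hy
  rw [mem_cls] at hy
  have := h.rf (-w) y (w - y) (by ring)
  rw [hw, hy] at this
  rw [mem_union, mem_cls, mem_cls]
  rcases this with h | h | h
  · exact absurd h hAB
  · exact .inl h.symm
  · exact .inr h.symm

theorem RF.rep_swap_of_left (h : RF n c₁ c₂ c₃) (hAB : A ≠ B) {w : ZMod p} (hw : c₁ (-w) = A) :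
    rep (cls c₂ A) (cls c₃ B) w = rep (cls c₂ B) (cls c₃ A) w := by
  have h1 := h.rep_add_rep hAB hw
  have h2 := h.swap₂₃.rep_add_rep hAB hw
  rw [rep_comm, rep_comm (cls c₃ B) (cls c₂ B)] at h2
  omega

/-- If `c₁ (-w)` is one of the two colors, both sides complement the same monochromatic count to the
same class size; otherwise both vanish. -/
theorem RF.rep_swap (h : RF n c₁ c₂ c₃) (hAB : A ≠ B) (w : ZMod p) :
    rep (cls c₂ A) (cls c₃ B) w = rep (cls c₂ B) (cls c₃ A) w := by
  by_cases hA : c₁ (-w) = A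
  · exact h.rep_swap_of_left hAB hA
  by_cases hB : c₁ (-w) = B
  · exact (h.rep_swap_of_left hAB.symm hB).symm
  have : ∀ {X Y}, X ≠ Y → c₁ (-w) ≠ X → c₁ (-w) ≠ Y → rep (cls c₂ X) (cls c₃ Y) w = 0 := by
    intro X Y hXY hX hY
    rw [rep, card_eq_zero, filter_eq_empty_iff]
    intro y hy hz
    rw [mem_cls] at hy hz
    rcases h.rf (-w) y (w - y) (by ring) with e | e | e
    · exact hX (e.trans hy)
    · exact hY (e.trans hz)
    · exact hXY (hy.symm.trans (e.trans hz))
  rw [this hAB hA hB, this hAB.symm hB hA]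

/-- The indicator of `S` as an element of the group algebra of `ℤ/pℤ` over `𝔽_p`. -/
noncomputable def elt (S : Finset (ZMod p)) : AddMonoidAlgebra (ZMod p) (ZMod p) :=
  ∑ x ∈ S, .single x 1

theorem coeff_elt_mul (S : Finset (ZMod p)) (g : AddMonoidAlgebra (ZMod p) (ZMod p))
    (w : ZMod p) : (elt S * g).coeff w = ∑ y ∈ S, g.coeff (w - y) := by
  rw [elt, sum_mul, AddMonoidAlgebra.coeff_sum, Finsupp.finsetSum_apply]
  refine sum_congr rfl fun y _ => ?_
  rw [AddMonoidAlgebra.coeff_single_mul_apply, one_mul, neg_add_eq_sub]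

theorem coeff_elt (S : Finset (ZMod p)) (w : ZMod p) :
    (elt S).coeff w = if w ∈ S then 1 else 0 := by
  rw [elt, AddMonoidAlgebra.coeff_sum, Finsupp.finsetSum_apply]
  simp [Finsupp.single_apply]

theorem coeff_elt_mul_elt (S T : Finset (ZMod p)) (w : ZMod p) :
    (elt S * elt T).coeff w = rep S T w := by
  simp [coeff_elt_mul, coeff_elt, rep]

/-- Frobenius, with p · x = 0. Hence `elt S ^ (p - 1)` inverts `elt S` up to a scalar, which is
nonzero unless p divides `#S`. -/
theorem elt_pow (S : Finset (ZMod p)) :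
    elt S ^ p = AddMonoidAlgebra.single 0 (#S : ZMod p) := by
  have : CharP (AddMonoidAlgebra (ZMod p) (ZMod p)) p :=
    charP_of_injective_algebraMap (algebraMap (ZMod p) _).injective p
  rw [elt, sum_pow_char]
  simp [AddMonoidAlgebra.single_pow]

/-- The automorphism of the group algebra induced by multiplication by a unit. -/
noncomputable def scale (u : (ZMod p)ˣ) :
    AddMonoidAlgebra (ZMod p) (ZMod p) ≃ₐ[ZMod p] AddMonoidAlgebra (ZMod p) (ZMod p) :=
  AddMonoidAlgebra.domCongr _ _ (DistribMulAction.toAddEquiv (ZMod p) u)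

theorem coeff_scale (u : (ZMod p)ˣ) (g : AddMonoidAlgebra (ZMod p) (ZMod p)) (x : ZMod p) :
    (scale u g).coeff x = g.coeff (x / u) := by
  rw [scale, AddMonoidAlgebra.coeff_domCongr]
  change g.coeff (u⁻¹ • x) = _
  rw [Units.smul_def, div_eq_inv_mul, Units.val_inv_eq_inv_val, smul_eq_mul]

theorem scale_elt (u : (ZMod p)ˣ) (c : ZMod p → κ) (X : κ) :
    scale u (elt (cls c X)) = elt (cls (fun x : ZMod p => c (x / u)) X) := by
  ext x
  simp [coeff_scale, coeff_elt]

/-- The quotient of two color classes in the group algebra, up to a scalar. -/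
noncomputable def quot (c : ZMod p → κ) (A B : κ) : AddMonoidAlgebra (ZMod p) (ZMod p) :=
  elt (cls c B) * elt (cls c A) ^ (p - 1)

theorem elt_mul_quot (c : ZMod p → κ) (A B : κ) :
    elt (cls c A) * quot c A B = (#(cls c A) : ZMod p) • elt (cls c B) := by
  have hp : p - 1 + 1 = p := Nat.sub_add_cancel (Fact.out : p.Prime).one_le
  rw [quot, mul_left_comm, ← pow_succ', hp, elt_pow]
  ext x
  simp [mul_comm]

/-- `RF.rep_swap` says that A_u B_v = B_u A_v for the scaled classes; dividing by the invertible A_u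
A_v equates the two scalings of B/A. -/
theorem RF.coeff_quot {c : ZMod p → κ} {u v : (ZMod p)ˣ}
    (h : RF n c₁ (fun x => c (x / u)) (fun x => c (x / v))) (hAB : A ≠ B)
    (hA : (#(cls c A) : ZMod p) ≠ 0) (x : ZMod p) :
    (quot c A B).coeff (x / u) = (quot c A B).coeff (x / v) := by
  have key : scale u (elt (cls c A)) * scale v (elt (cls c B)) =
      scale u (elt (cls c B)) * scale v (elt (cls c A)) := by
    ext w
    rw [scale_elt, scale_elt, scale_elt, scale_elt, coeff_elt_mul_elt, coeff_elt_mul_elt,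
      h.rep_swap hAB]
  have hp : p - 1 + 1 = p := Nat.sub_add_cancel (Fact.out : p.Prime).one_le
  have hs : ∀ t : (ZMod p)ˣ, scale t (elt (cls c A)) ^ (p - 1) * scale t (elt (cls c A)) =
      algebraMap (ZMod p) _ (#(cls c A) : ZMod p) := by
    intro t
    rw [← pow_succ, hp, ← map_pow, elt_pow]
    exact (scale t).commutes _
  have e : (#(cls c A) : ZMod p) • scale u (quot c A B) =
      (#(cls c A) : ZMod p) • scale v (quot c A B) := by
    rw [Algebra.smul_def, Algebra.smul_def]
    nth_rw 1 [← hs v]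
    rw [← hs u, quot, map_mul, map_mul, map_pow, map_pow]
    linear_combination (-(scale u (elt (cls c A)) ^ (p - 1) * scale v (elt (cls c A)) ^ (p - 1))) *
      key
  have := congrArg (fun g => g.coeff x) e
  simpa [coeff_scale, hA] using this

end GroupAlgebra

end RainbowFree

/-! ### Three colors when the ratios generate all units. -/

namespace RainbowFree

open Finset ZModSumset Polynomial
open scoped Pointwise

set_option linter.unusedSectionVars false

variable {p : ℕ} [Fact p.Prime] {κ : Type*} [DecidableEq κ]

/-- Functions on `ℤ/pℤ` invariant under multiplication by squares. -/
theorem eq_of_square_invariant {m : ℕ} (hm : 2 * m + 1 = p) (hm0 : m ≠ 0) {ψ : ZMod p → ZMod p}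
    (hψ : ∀ (h : (ZMod p)ˣ) x, ψ (h ^ 2 * x) = ψ x) :
    ∃ w u v, ∀ x, ψ x = w + v * x ^ m + if x = 0 then u else 0 := by
  have h2 : (2 : ZMod p) ≠ 0 := by
    exact_mod_cast ThreeValued.natCast_ne_zero_of_lt (p := p) (k := 2) (by omega) (by omega)
  have hp2 : p / 2 = m := by omega
  obtain ⟨g, hg⟩ : ∃ g : ZMod p, ¬ IsSquare g :=
    FiniteField.exists_nonsquare (by rw [ZMod.ringChar_zmod_n]; omega)
  have hg0 : g ≠ 0 := by rintro rfl; exact hg IsSquare.zero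
  have hgm : g ^ m = -1 := by
    rcases ZMod.pow_div_two_eq_neg_one_or_one p hg0 with h | h
    · exact absurd ((ZMod.euler_criterion p hg0).2 h) hg
    · rwa [hp2] at h
  have hsq : ∀ x y : ZMod p, x ≠ 0 → y ≠ 0 → x ^ m = y ^ m → ψ x = ψ y := by
    intro x y hx hy h
    have hxy : x / y ≠ 0 := div_ne_zero hx hy
    obtain ⟨t, ht⟩ := (ZMod.euler_criterion p hxy).2 (by
      rw [hp2, div_pow, h, div_self (pow_ne_zero _ hy)])
    have ht0 : t ≠ 0 := by rintro rfl; simp at ht; tauto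
    rw [← hψ (Units.mk0 t ht0) y, Units.val_mk0, pow_two, ← ht, div_mul_cancel₀ _ hy]
  refine ⟨(ψ 1 + ψ g) / 2, ψ 0 - (ψ 1 + ψ g) / 2, (ψ 1 - ψ g) / 2, fun x => ?_⟩
  by_cases hx : x = 0
  · subst hx; simp [hm0]
  rw [if_neg hx]
  rcases ZMod.pow_div_two_eq_neg_one_or_one p hx with h | h <;> rw [hp2] at h
  · rw [hsq x 1 hx one_ne_zero (by rw [h, one_pow]), h]
    field_simp
    ring
  · rw [hsq x g hx hg0 (by rw [h, hgm]), h]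
    field_simp
    ring

theorem RF.rot {n : κ → ℕ} {c₁ c₂ c₃ : ZMod p → κ} (h : RF n c₁ c₂ c₃) : RF n c₃ c₁ c₂ := h.swap₂₃.swap₁₂

theorem rf_units {u₁ u₂ u₃ : (ZMod p)ˣ} {c : ZMod p → κ}
    (hc : ∀ x y z, (u₁ : ZMod p) * x + u₂ * y + u₃ * z = 0 → c x = c y ∨ c x = c z ∨ c y = c z) :
    RF (fun X => #(cls c X)) (fun x : ZMod p => c (x / u₁)) (fun x : ZMod p => c (x / u₂))
      (fun x : ZMod p => c (x / u₃)) := by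
  have := RF.of_coloring c u₁.ne_zero u₂.ne_zero u₃.ne_zero hc
  simpa using this

/-- The stabilizer of the quotient contains every uᵢ/uⱼ; squaring absorbs the signs of the
generators. -/
theorem coeff_quot_square {u₁ u₂ u₃ : (ZMod p)ˣ}
    (hH : Subgroup.closure {-(u₁ / u₂), -(u₁ / u₃), -(u₂ / u₃)} = ⊤) {c : ZMod p → κ}
    (hc : ∀ x y z, (u₁ : ZMod p) * x + u₂ * y + u₃ * z = 0 → c x = c y ∨ c x = c z ∨ c y = c z)
    {A B : κ} (hAB : A ≠ B) (hA : (#(cls c A) : ZMod p) ≠ 0) (h : (ZMod p)ˣ) (x : ZMod p) :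
    (quot c A B).coeff (h ^ 2 * x) = (quot c A B).coeff x := by
  let K : Subgroup (ZMod p)ˣ :=
    { carrier := {g | ∀ x, (quot c A B).coeff (g * x) = (quot c A B).coeff x}
      one_mem' := fun x => by rw [Units.val_one, one_mul]
      mul_mem' := fun {g h} hg hh x => by rw [Units.val_mul, mul_assoc, hg, hh]
      inv_mem' := fun {g} hg x => by rw [← hg, ← mul_assoc, Units.mul_inv, one_mul] }
  have hrf := rf_units hc
  have hK : ∀ {u v : (ZMod p)ˣ} {c₁ : ZMod p → κ},
      RF (fun X => #(cls c X)) c₁ (fun x : ZMod p => c (x / u)) (fun x : ZMod p => c (x / v)) →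
      -(u / v) ∈ K.comap (powMonoidHom 2) := by
    intro u v c₁ hr
    have huv : u / v ∈ K := by
      intro x
      have := hr.coeff_quot hAB hA (u * x)
      rw [mul_div_cancel_left₀ _ u.ne_zero, mul_div_right_comm] at this
      rw [this, Units.val_div_eq_div_val]
    rw [Subgroup.mem_comap, powMonoidHom_apply, neg_sq]
    exact pow_mem huv 2
  have hle : Subgroup.closure {-(u₁ / u₂), -(u₁ / u₃), -(u₂ / u₃)} ≤ K.comap (powMonoidHom 2) := by
    rw [Subgroup.closure_le]
    rintro _ (rfl | rfl | rfl)
    · exact hK hrf.rot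
    · exact hK hrf.swap₁₂
    · exact hK hrf
  rw [hH] at hle
  have := hle (Subgroup.mem_top h) x
  simpa using this

theorem exists_pow_of_rainbowFree {m : ℕ} (hm : 2 * m + 1 = p) (hp : 5 ≤ p) {u₁ u₂ u₃ : (ZMod p)ˣ}
    (hH : Subgroup.closure {-(u₁ / u₂), -(u₁ / u₃), -(u₂ / u₃)} = ⊤) {c : ZMod p → Fin 3}
    (hsurj : Function.Surjective c)
    (hc : ∀ x y z, (u₁ : ZMod p) * x + u₂ * y + u₃ * z = 0 → c x = c y ∨ c x = c z ∨ c y = c z) :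
    ∃ r : ZMod p, ∀ x y, c x = c y → (x - r) ^ m = (y - r) ^ m := by
  have hA : (#(cls c 0) : ZMod p) ≠ 0 := by
    obtain ⟨x, hx⟩ := hsurj 0
    obtain ⟨y, hy⟩ := hsurj 1
    refine ThreeValued.natCast_ne_zero_of_lt (card_pos.2 ⟨x, mem_cls.2 hx⟩) ?_
    refine lt_of_lt_of_eq (card_lt_card ⟨subset_univ _, fun h => ?_⟩) ((card_univ (α := ZMod p)).trans (ZMod.card p))
    have := h (mem_univ y)
    rw [mem_cls, hy] at this
    exact absurd this (by decide)
  obtain ⟨w, u, v, hψ⟩ := eq_of_square_invariant hm (by omega)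
    (coeff_quot_square hH hc (A := 0) (B := 1) (by decide) hA)
  set α : ZMod p := (#(cls c 0) : ZMod p) with hα
  -- Convolving the quotient with class 0 turns its quadratic-character part into this polynomial,
  -- whose value then depends on the color alone.
  let f : (ZMod p)[X] := ∑ y ∈ cls c 0, (X - C y) ^ m
  have hf : ∀ x, f.eval x = ∑ y ∈ cls c 0, (x - y) ^ m := fun x => by
    simp [f, eval_finsetSum]
  have key : ∀ x, (if c x = 1 then α else 0) = α * w + v * f.eval x + if c x = 0 then u else 0 := by
    intro x
    have h := congrArg (fun g => g.coeff x) (elt_mul_quot c 0 1)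
    simp only [coeff_elt_mul, AddMonoidAlgebra.coeff_smul, Finsupp.smul_apply, coeff_elt, mem_cls,
      smul_eq_mul, hψ, sum_add_distrib, ← mul_sum, ← hf, sub_eq_zero, sum_const, nsmul_eq_mul,
      sum_ite_eq, ← hα, mul_ite, mul_one, mul_zero] at h
    exact h.symm
  -- For v = 0, `key` could not tell colors 1 and 2 apart.
  have hv : v ≠ 0 := by
    rintro rfl
    obtain ⟨y, hy⟩ := hsurj 1
    obtain ⟨z, hz⟩ := hsurj 2
    have h1 := key y
    have h2 := key z
    simp [hy, hz] at h1 h2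
    rcases h2 with h2 | h2
    · exact hA h2
    · rw [h2, mul_zero] at h1; exact hA h1
  let val : Fin 3 → ZMod p := fun i =>
    ((if i = 1 then α else 0) - (if i = 0 then u else 0) - α * w) / v
  have hval : ∀ x, f.eval x = val (c x) := by
    intro x
    rw [eq_div_iff hv, key x]
    ring
  have hdeg : f.natDegree = m := by
    refine natDegree_eq_of_le_of_coeff_ne_zero ?_ ?_
    · refine natDegree_sum_le_of_forall_le _ _ fun y _ => ?_
      refine natDegree_pow_le.trans ?_
      simp
    · have : f.coeff m = α := by
        simp only [f, finsetSum_coeff]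
        rw [hα, ← nsmul_one, ← sum_const]
        refine sum_congr rfl fun y _ => ?_
        have h1 := (monic_X_sub_C y).pow m
        have h2 : ((X - C y) ^ m).natDegree = m := by simp
        rw [Monic, leadingCoeff, h2] at h1
        exact h1
      rw [this]
      exact hA
  obtain ⟨r, s, d, e⟩ := ThreeValued.eq_pow_of_three_values hm hp hdeg
    (fun x => ⟨c x, hval x⟩) (fun i => by
      obtain ⟨x, hx⟩ := hsurj i
      exact ⟨x, by rw [hval, hx]⟩)
  have hd : d ≠ 0 := by
    rintro rfl
    rw [e] at hdeg
    simp at hdeg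
    omega
  refine ⟨r, fun x y hxy => ?_⟩
  have h1 : f.eval x = f.eval y := by rw [hval, hval, hxy]
  rw [e] at h1
  simpa [hd] using h1

/-- If `-ab` is not a square then `a u + b v = κ` has a solution in which exactly one of the
nonzero elements `u`, `v` is a square. -/
theorem exists_solution_ne {m : ℕ} (hm : 2 * m + 1 = p) (hp : 5 ≤ p) {a b : ZMod p} (ha : a ≠ 0)
    (hb : b ≠ 0) (hab : (-(a * b)) ^ m = -1) (k : ZMod p) :
    ∃ u v, u ≠ 0 ∧ v ≠ 0 ∧ u ^ m ≠ v ^ m ∧ a * u + b * v = k := by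
  have h2 : (2 : ZMod p) ≠ 0 := by
    exact_mod_cast ThreeValued.natCast_ne_zero_of_lt (p := p) (k := 2) (by omega) (by omega)
  have h3 : (3 : ZMod p) ≠ 0 := by
    exact_mod_cast ThreeValued.natCast_ne_zero_of_lt (p := p) (k := 3) (by omega) (by omega)
  have main : ∀ u v t : ZMod p, u ≠ 0 → t ≠ 0 → u * v = -(a * b) * t ^ 2 → u ^ m ≠ v ^ m := by
    intro u v t hu ht e hne
    have h1 : (u * v) ^ m = -1 := by
      rw [e, mul_pow, hab, ← pow_mul, show 2 * m = p - 1 by omega, ZMod.pow_card_sub_one_eq_one ht,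
        mul_one]
    rw [mul_pow, ← hne, ← pow_add, show m + m = p - 1 by omega,
      ZMod.pow_card_sub_one_eq_one hu] at h1
    exact h2 (by linear_combination h1)
  by_cases hk : k = 0
  · have hv : -(a / b) ≠ 0 := neg_ne_zero.2 (div_ne_zero ha hb)
    refine ⟨1, -(a / b), one_ne_zero, hv, main _ _ b⁻¹ one_ne_zero (inv_ne_zero hb) ?_, ?_⟩
    · field_simp
    · rw [hk]; field_simp; ring
  · have h4 : (4 : ZMod p) ≠ 0 := by
      rw [show (4 : ZMod p) = 2 * 2 by norm_num]; exact mul_ne_zero h2 h2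
    -- The weights -1/3 and 4/3 add up to 1 and their product is minus a square, so uv is -ab times
    -- a square.
    refine ⟨-k / (3 * a), 4 * k / (3 * b), by simp [hk, h3, ha], by simp [hk, h3, hb, h4],
      main _ _ (2 * k / (3 * a * b)) (by simp [hk, h3, ha]) (by simp [hk, h3, ha, hb, h2]) ?_, ?_⟩
    · field_simp; ring
    · field_simp; ring

/-- Around `r` the color determines the quadratic character. A nonsquare generator -(b/d) would
give, by `exists_solution_ne`, a rainbow solution r, r + u, r + v. So all generators are squares and
cannot generate every unit. -/
theorem exists_rainbow_of_closure_eq_top_of_five_le {m : ℕ} (hm : 2 * m + 1 = p) (hp : 5 ≤ p)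
    {u₁ u₂ u₃ : (ZMod p)ˣ}
    (hH : Subgroup.closure {-(u₁ / u₂), -(u₁ / u₃), -(u₂ / u₃)} = ⊤) {c : ZMod p → Fin 3}
    (hsurj : Function.Surjective c) :
    ¬ ∀ x y z, (u₁ : ZMod p) * x + u₂ * y + u₃ * z = 0 → c x = c y ∨ c x = c z ∨ c y = c z := by
  intro hc
  have hm0 : m ≠ 0 := by omega
  obtain ⟨r, hr⟩ := exists_pow_of_rainbowFree hm hp hH hsurj hc
  have main : ∀ {x y z : ZMod p}, x - r = 0 → y - r ≠ 0 → z - r ≠ 0 → (y - r) ^ m ≠ (z - r) ^ m →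
      c x ≠ c y ∧ c x ≠ c z ∧ c y ≠ c z := by
    intro x y z hx hy hz hyz
    refine ⟨fun e => ?_, fun e => ?_, fun e => hyz (hr _ _ e)⟩
    · have := hr _ _ e
      rw [hx, zero_pow hm0] at this
      exact pow_ne_zero _ hy this.symm
    · have := hr _ _ e
      rw [hx, zero_pow hm0] at this
      exact pow_ne_zero _ hz this.symm
  have step : ∀ {a b d : (ZMod p)ˣ},
      (∀ x y z, (a : ZMod p) * x + b * y + d * z = 0 → ¬ (c x ≠ c y ∧ c x ≠ c z ∧ c y ≠ c z)) →
      -(b / d) ∈ (powMonoidHom m : (ZMod p)ˣ →* (ZMod p)ˣ).ker := by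
    intro a b d h
    have hbd : (-((b : ZMod p) * d)) ^ m = 1 := by
      have h0 : (-((b : ZMod p) * d)) ≠ 0 := by simp
      rcases ZMod.pow_div_two_eq_neg_one_or_one p h0 with e | e <;>
        rw [show p / 2 = m by omega] at e
      · exact e
      exfalso
      obtain ⟨u, v, hu, hv, huv, e⟩ := exists_solution_ne hm hp b.ne_zero d.ne_zero e
        (-((a + b + d : ZMod p) * r))
      refine h r (r + u) (r + v) (by linear_combination e) (main ?_ ?_ ?_ ?_)
      · simp
      · simpa using hu
      · simpa using hv
      · simpa using huv
    rw [MonoidHom.mem_ker]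
    ext
    have h1 : (-((b : ZMod p) / d)) = -(b * d) * (d⁻¹ : ZMod p) ^ 2 := by
      have := d.ne_zero
      field_simp
    simp only [powMonoidHom_apply, Units.val_pow_eq_pow_val, Units.val_neg, Units.val_div_eq_div_val,
      Units.val_one]
    rw [h1, mul_pow, hbd, ← pow_mul, show 2 * m = p - 1 by omega,
      ZMod.pow_card_sub_one_eq_one (inv_ne_zero d.ne_zero), mul_one]
  have hle : Subgroup.closure {-(u₁ / u₂), -(u₁ / u₃), -(u₂ / u₃)} ≤
      (powMonoidHom m : (ZMod p)ˣ →* (ZMod p)ˣ).ker := by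
    rw [Subgroup.closure_le]
    rintro _ (rfl | rfl | rfl)
    · refine step (a := u₃) fun x y z e h => ?_
      rcases hc y z x (by linear_combination e) with e | e | e
      · exact h.2.2 e
      · exact h.1 e.symm
      · exact h.2.1 e.symm
    · refine step (a := u₂) fun x y z e h => ?_
      rcases hc y x z (by linear_combination e) with e | e | e
      · exact h.1 e.symm
      · exact h.2.2 e
      · exact h.2.1 e
    · refine step (a := u₁) fun x y z e h => ?_
      rcases hc x y z (by linear_combination e) with e | e | e
      · exact h.1 e
      · exact h.2.1 e
      · exact h.2.2 e
  obtain ⟨g, hg⟩ : ∃ g : ZMod p, ¬ IsSquare g :=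
    FiniteField.exists_nonsquare (by rw [ZMod.ringChar_zmod_n]; omega)
  have hg0 : g ≠ 0 := by rintro rfl; exact hg IsSquare.zero
  refine hg ((ZMod.euler_criterion p hg0).2 ?_)
  rw [hH] at hle
  have := congrArg Units.val (MonoidHom.mem_ker.1 (hle (Subgroup.mem_top (Units.mk0 g hg0))))
  rw [show p / 2 = m by omega]
  simpa using this

theorem exists_solution_zmod_three : ∀ a b d : ZMod 3, a ≠ 0 → b ≠ 0 → d ≠ 0 → a + b + d ≠ 0 →
    ∃ x y z, a * x + b * y + d * z = 0 ∧ x ≠ y ∧ x ≠ z ∧ y ≠ z := by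
  decide

theorem exists_rainbow_of_closure_eq_top {u₁ u₂ u₃ : (ZMod p)ˣ}
    (hs : (u₁ + u₂ + u₃ : ZMod p) ≠ 0)
    (hH : Subgroup.closure {-(u₁ / u₂), -(u₁ / u₃), -(u₂ / u₃)} = ⊤) {c : ZMod p → Fin 3}
    (hsurj : Function.Surjective c) :
    ¬ ∀ x y z, (u₁ : ZMod p) * x + u₂ * y + u₃ * z = 0 → c x = c y ∨ c x = c z ∨ c y = c z := by
  have h3 : 3 ≤ p := by simpa using Fintype.card_le_of_surjective c hsurj
  rcases h3.eq_or_lt with rfl | h4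
  · intro hc
    have hinj : Function.Injective c :=
      ((Fintype.bijective_iff_surjective_and_card c).2 ⟨hsurj, by simp⟩).1
    obtain ⟨x, y, z, e, h1, h2, h3⟩ := exists_solution_zmod_three _ _ _ u₁.ne_zero u₂.ne_zero u₃.ne_zero hs
    rcases hc x y z e with h | h | h
    · exact h1 (hinj h)
    · exact h2 (hinj h)
    · exact h3 (hinj h)
  · have hp : p.Prime := Fact.out
    obtain ⟨m, hm⟩ := hp.odd_of_ne_two (by omega)
    exact exists_rainbow_of_closure_eq_top_of_five_le hm.symm (by omega) hH hsurj

end RainbowFree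

/-! ### Rainbow numbers and coset colorings of ℤ/pℤ. -/

namespace RainbowFree

open Finset

variable {a₁ a₂ a₃ b : ℤ}

theorem not_forcesRainbow_iff {n r : ℕ} : ¬ ForcesRainbow n a₁ a₂ a₃ b r ↔
    ∃ c : ZMod n → Fin r, Function.Surjective c ∧ ∀ x y z, IsSolution n a₁ a₂ a₃ b x y z →
      c x = c y ∨ c x = c z ∨ c y = c z := by
  unfold ForcesRainbow HasRainbowSolution
  push Not
  refine exists_congr fun c => and_congr_right fun _ => ?_
  refine forall_congr' fun x => forall_congr' fun y => forall_congr' fun z => imp_congr_right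
    fun _ => ?_
  rw [or_iff_not_imp_left, or_iff_not_imp_left]

theorem not_forcesRainbow_of_surjective {n : ℕ} {κ : Type*} [Fintype κ] (c : ZMod n → κ)
    (hc : Function.Surjective c) (h : ∀ x y z, IsSolution n a₁ a₂ a₃ b x y z →
      c x = c y ∨ c x = c z ∨ c y = c z) :
    ¬ ForcesRainbow n a₁ a₂ a₃ b (Fintype.card κ) := by
  refine not_forcesRainbow_iff.2 ⟨Fintype.equivFin κ ∘ c, (Fintype.equivFin κ).surjective.comp hc,
    fun x y z e => ?_⟩
  simpa using h x y z e

theorem not_forcesRainbow_mono {n r s : ℕ} (hr : 0 < r) (hrs : r ≤ s)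
    (h : ¬ ForcesRainbow n a₁ a₂ a₃ b s) : ¬ ForcesRainbow n a₁ a₂ a₃ b r := by
  obtain ⟨c, hc, hav⟩ := not_forcesRainbow_iff.1 h
  -- Merging all colors from r - 1 on creates no rainbow solution.
  let g : Fin s → Fin r := fun i => ⟨min i (r - 1), by omega⟩
  have hg : Function.Surjective g := fun i =>
    ⟨⟨i, by omega⟩, Fin.ext (by change min (i : ℕ) (r - 1) = i; omega)⟩
  refine not_forcesRainbow_iff.2 ⟨g ∘ c, hg.comp hc, fun x y z e => ?_⟩
  rcases hav x y z e with h | h | h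
  · exact .inl (congrArg g h)
  · exact .inr (.inl (congrArg g h))
  · exact .inr (.inr (congrArg g h))

theorem lt_rb {n s : ℕ} (hn : n ≠ 0) (h : ¬ ForcesRainbow n a₁ a₂ a₃ b s) :
    s < rb n a₁ a₂ a₃ b := by
  have hl := (rb_isLeast n hn a₁ a₂ a₃ b).1
  by_contra! hlt
  exact not_forcesRainbow_mono hl.1 hlt h hl.2

theorem not_forcesRainbow_one (n : ℕ) : ¬ ForcesRainbow n a₁ a₂ a₃ b 1 :=
  not_forcesRainbow_iff.2 ⟨fun _ => 0, fun _ => ⟨0, Subsingleton.elim _ _⟩, fun _ _ _ _ => .inl rfl⟩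

theorem two_le_rb {n : ℕ} (hn : n ≠ 0) : 2 ≤ rb n a₁ a₂ a₃ b :=
  lt_rb hn (not_forcesRainbow_one n)

section Prime

variable {p : ℕ} [Fact p.Prime]

theorem not_forcesRainbow_two : ¬ ForcesRainbow p a₁ a₂ a₃ b 2 := by
  refine not_forcesRainbow_iff.2 ⟨fun x => if x = 0 then 0 else 1, fun i => ?_,
    fun x y z _ => by dsimp only; split_ifs <;> simp⟩
  fin_cases i
  · exact ⟨0, by simp⟩
  · exact ⟨1, by simp⟩

/-- Membership in a subgroup of units propagates along solutions of `u x + v y = 0`. -/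
theorem exists_mem_iff {H : Subgroup (ZMod p)ˣ} {u v : (ZMod p)ˣ} (h : -(u / v) ∈ H) {x y : ZMod p}
    (e : (u : ZMod p) * x + v * y = 0) :
    (∃ g ∈ H, (g : ZMod p) = x) ↔ ∃ g ∈ H, (g : ZMod p) = y := by
  have hu := u.ne_zero
  have hv := v.ne_zero
  constructor
  · rintro ⟨g, hg, rfl⟩
    refine ⟨-(u / v) * g, mul_mem h hg, ?_⟩
    simp only [Units.val_mul, Units.val_neg, Units.val_div_eq_div_val]
    field_simp
    linear_combination -e
  · rintro ⟨g, hg, rfl⟩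
    refine ⟨(-(u / v))⁻¹ * g, mul_mem (inv_mem h) hg, ?_⟩
    simp only [Units.val_mul, Units.val_neg, Units.val_div_eq_div_val, Units.val_inv_eq_inv_val]
    field_simp
    linear_combination -e

open Classical in
/-- The coloring of `ℤ/pℤ` with classes `{t}`, `t + H` and the rest. -/
noncomputable def cosetColoring (H : Subgroup (ZMod p)ˣ) (t x : ZMod p) : Option (Fin 2) :=
  if x = t then none else if ∃ g ∈ H, (g : ZMod p) = x - t then some 0 else some 1

theorem cosetColoring_eq_none {H : Subgroup (ZMod p)ˣ} {t x : ZMod p} :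
    cosetColoring H t x = none ↔ x = t := by
  unfold cosetColoring
  split_ifs <;> simp_all

theorem cosetColoring_eq {H : Subgroup (ZMod p)ˣ} {t x y : ZMod p} (hx : x ≠ t) (hy : y ≠ t)
    {u v : (ZMod p)ˣ} (h : -(u / v) ∈ H) (e : (u : ZMod p) * (x - t) + v * (y - t) = 0) :
    cosetColoring H t x = cosetColoring H t y := by
  unfold cosetColoring
  rw [if_neg hx, if_neg hy]
  classical exact if_congr (exists_mem_iff h e) rfl rfl

theorem cosetColoring_surjective {H : Subgroup (ZMod p)ˣ} (hH : H ≠ ⊤) (t : ZMod p) :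
    Function.Surjective (cosetColoring H t) := by
  obtain ⟨g, hg⟩ : ∃ g, g ∉ H := by
    by_contra! h
    exact hH ((Subgroup.eq_top_iff' H).2 h)
  intro i
  match i with
  | none => exact ⟨t, cosetColoring_eq_none.2 rfl⟩
  | some 0 =>
    refine ⟨t + 1, ?_⟩
    unfold cosetColoring
    rw [if_neg (by simp), if_pos ⟨1, one_mem H, by simp⟩]
  | some 1 =>
    refine ⟨t + g, ?_⟩
    unfold cosetColoring
    rw [if_neg (by simp), if_neg]
    rintro ⟨g', hg', e⟩
    rw [add_sub_cancel_left, Units.val_inj] at e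
    exact hg (e ▸ hg')

/-- A rainbow solution has an entry equal to `t`; its term vanishes, and the two-term equation left
puts the other entries in the same class. -/
theorem cosetColoring_avoids {u₁ u₂ u₃ : (ZMod p)ˣ} {H : Subgroup (ZMod p)ˣ}
    (h₁₂ : -(u₁ / u₂) ∈ H) (h₁₃ : -(u₁ / u₃) ∈ H) (h₂₃ : -(u₂ / u₃) ∈ H) {t : ZMod p} (x y z : ZMod p)
    (e : (u₁ : ZMod p) * (x - t) + u₂ * (y - t) + u₃ * (z - t) = 0) :
    cosetColoring H t x = cosetColoring H t y ∨ cosetColoring H t x = cosetColoring H t z ∨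
      cosetColoring H t y = cosetColoring H t z := by
  by_contra! hne
  obtain ⟨hxy, hxz, hyz⟩ := hne
  have key : ∀ A B C : Option (Fin 2), A ≠ B → A ≠ C → B ≠ C → A = none ∨ B = none ∨ C = none := by
    decide
  have ht : ∀ {x y}, cosetColoring H t x ≠ cosetColoring H t y → x = t → y ≠ t := by
    rintro x y h rfl rfl
    exact h rfl
  rcases key _ _ _ hxy hxz hyz with h | h | h <;> rw [cosetColoring_eq_none] at h
  · exact hyz (cosetColoring_eq (ht hxy h) (ht hxz h) h₂₃ (by rw [h] at e; linear_combination e))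
  · exact hxz (cosetColoring_eq (ht hxy.symm h) (ht hyz h) h₁₃
      (by rw [h] at e; linear_combination e))
  · exact hxy (cosetColoring_eq (ht hxz.symm h) (ht hyz.symm h) h₁₂
      (by rw [h] at e; linear_combination e))

/-- There is a rainbow-free coloring with `rb p - 1` colors in which the fixed point `t` of the
equation is alone in its color class. -/
theorem exists_coloring_singleton (h₁ : (a₁ : ZMod p) ≠ 0) (h₂ : (a₂ : ZMod p) ≠ 0)
    (h₃ : (a₃ : ZMod p) ≠ 0) (hs : (a₁ + a₂ + a₃ : ZMod p) ≠ 0) {t : ZMod p}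
    (ht : (a₁ + a₂ + a₃ : ZMod p) * t = b) :
    ∃ c : ZMod p → Option (Fin (rb p a₁ a₂ a₃ b - 2)), Function.Surjective c ∧
      (∀ x, c x = none ↔ x = t) ∧ ∀ x y z, IsSolution p a₁ a₂ a₃ b x y z →
        c x = c y ∨ c x = c z ∨ c y = c z := by
  have hp0 : p ≠ 0 := (Fact.out : p.Prime).ne_zero
  have hle : rb p a₁ a₂ a₃ b ≤ 4 :=
    (rb_isLeast p hp0 a₁ a₂ a₃ b).2 ⟨by norm_num, forcesRainbow_four a₁ a₂ a₃ b h₁ h₂ h₃⟩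
  have hge : 2 < rb p a₁ a₂ a₃ b := lt_rb hp0 not_forcesRainbow_two
  rcases (by omega : rb p a₁ a₂ a₃ b = 3 ∨ rb p a₁ a₂ a₃ b = 4) with h | h
  · rw [h]
    refine ⟨fun x => if x = t then none else some 0, fun i => ?_, fun x => by simp,
      fun x y z _ => by dsimp only; split_ifs <;> simp⟩
    match i with
    | none => exact ⟨t, by simp⟩
    | some 0 => exact ⟨t + 1, by simp⟩
  · have hnf : ¬ ForcesRainbow p a₁ a₂ a₃ b 3 := fun hf => by
      have := (rb_isLeast p hp0 a₁ a₂ a₃ b).2 ⟨by norm_num, hf⟩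
      omega
    rw [h]
    obtain ⟨c, hc, hav⟩ := not_forcesRainbow_iff.1 hnf
    let H : Subgroup (ZMod p)ˣ := Subgroup.closure {-(Units.mk0 _ h₁ / Units.mk0 _ h₂),
      -(Units.mk0 _ h₁ / Units.mk0 _ h₃), -(Units.mk0 _ h₂ / Units.mk0 _ h₃)}
    -- Translation by `t` makes the equation homogeneous.
    have hH : H ≠ ⊤ := by
      intro hH
      refine exists_rainbow_of_closure_eq_top (c := fun x => c (x + t)) (by simpa using hs) hH
        (hc.comp (add_right_surjective t)) fun x y z e => hav _ _ _ ?_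
      simp only [Units.val_mk0] at e
      unfold IsSolution
      rw [← ht]
      linear_combination e
    refine ⟨cosetColoring H t, cosetColoring_surjective hH t, fun x => cosetColoring_eq_none,
      fun x y z e => cosetColoring_avoids (u₁ := Units.mk0 _ h₁) (u₂ := Units.mk0 _ h₂)
        (u₃ := Units.mk0 _ h₃) (Subgroup.subset_closure (by simp))
        (Subgroup.subset_closure (by simp)) (Subgroup.subset_closure (by simp)) x y z ?_⟩
    unfold IsSolution at e
    simp only [Units.val_mk0]
    rw [← ht] at e
    linear_combination e

end Prime

end RainbowFree

/-! ### The product coloring and induction over prime factors. -/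

namespace RainbowFree

open Finset

variable {a₁ a₂ a₃ b : ℤ}

theorem isUnit_intCast_of_dvd {m n : ℕ} (h : m ∣ n) {a : ℤ} (ha : IsUnit (a : ZMod n)) :
    IsUnit (a : ZMod m) := by
  simpa using ha.map (ZMod.castHom h (ZMod m))

theorem isSolution_intCast {n : ℕ} {x y z : ℤ} :
    IsSolution n a₁ a₂ a₃ b x y z ↔ (n : ℤ) ∣ a₁ * x + a₂ * y + a₃ * z - b := by
  rw [← ZMod.intCast_zmod_eq_zero_iff_dvd, IsSolution]
  push_cast
  rw [sub_eq_zero]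

section Product

variable {p m : ℕ} {κ : Type*} {r : ℕ}

/-- The coloring of `ℤ/pmℤ` which uses `c` on the residues that do not reduce to the class
`none` modulo `p`, and `d` on `t + pℤ`. -/
def productColoring (t : ℤ) (c : ZMod p → Option κ) (d : ZMod m → Fin r) (x : ZMod (p * m)) :
    κ ⊕ Fin r :=
  match c x.val with
  | some i => .inl i
  | none => .inr (d (((x.val - t) / p + t : ℤ) : ZMod m))

theorem productColoring_of_some {t : ℤ} {c : ZMod p → Option κ} {d : ZMod m → Fin r}
    {x : ZMod (p * m)} {i : κ} (h : c x.val = some i) :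
    productColoring t c d x = .inl i := by
  simp [productColoring, h]

theorem productColoring_of_none {t : ℤ} {c : ZMod p → Option κ} {d : ZMod m → Fin r}
    {x : ZMod (p * m)} (h : c x.val = none) :
    productColoring t c d x = .inr (d (((x.val - t) / p + t : ℤ) : ZMod m)) := by
  simp [productColoring, h]

theorem productColoring_surjective (hp : p ≠ 0) (hm : m ≠ 0) {t : ℤ} {c : ZMod p → Option κ}
    {d : ZMod m → Fin r} (hc : Function.Surjective c) (hd : Function.Surjective d)
    (hct : c t = none) : Function.Surjective (productColoring t c d) := by
  have : NeZero p := ⟨hp⟩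
  have : NeZero m := ⟨hm⟩
  rintro (i | j)
  · obtain ⟨x, hx⟩ := hc (some i)
    refine ⟨(x.val : ZMod (p * m)), productColoring_of_some ?_⟩
    rw [ZMod.val_natCast_of_lt, ZMod.natCast_zmod_val, hx]
    exact x.val_lt.trans_le (Nat.le_mul_of_pos_right _ (by omega))
  · obtain ⟨w, hw⟩ := hd j
    set X : ZMod (p * m) := ((t + p * (w.val - t) : ℤ) : ZMod (p * m)) with hX
    have h1 : ((X.val : ℤ) : ZMod (p * m)) = ((t + p * (w.val - t) : ℤ) : ZMod (p * m)) := by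
      rw [← hX]
      simp
    rw [ZMod.intCast_eq_intCast_iff_dvd_sub] at h1
    obtain ⟨q, hq⟩ := h1
    have hval : (X.val : ℤ) = t + p * (w.val - t - m * q) := by
      push_cast at hq
      linear_combination -hq
    refine ⟨X, ?_⟩
    rw [productColoring_of_none]
    · rw [hval, add_sub_cancel_left, Int.mul_ediv_cancel_left _ (by exact_mod_cast hp)]
      rw [← hw]
      congr 2
      push_cast
      simp
    · have : ((X.val : ℕ) : ZMod p) = ((X.val : ℤ) : ZMod p) := by simp
      rw [this, hval]
      push_cast
      simpa using hct

/-- If the entries are t + p qᵢ, then Σ aᵢ qᵢ ≡ 0 modulo m, because (t, t, t) is a solution. Adding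
`t` to each qᵢ restores the right-hand side `b`, hence the shift in `productColoring`. -/
theorem productColoring_avoids [Fact p.Prime] (hm : m ≠ 0) (h₁ : (a₁ : ZMod p) ≠ 0)
    (h₂ : (a₂ : ZMod p) ≠ 0) (h₃ : (a₃ : ZMod p) ≠ 0) {t : ℤ}
    (ht : ((p * m : ℕ) : ℤ) ∣ (a₁ + a₂ + a₃) * t - b) {c : ZMod p → Option κ} {d : ZMod m → Fin r}
    (hct : ∀ x, c x = none ↔ x = t)
    (hc : ∀ x y z, IsSolution p a₁ a₂ a₃ b x y z → c x = c y ∨ c x = c z ∨ c y = c z)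
    (hd : ∀ x y z, IsSolution m a₁ a₂ a₃ b x y z → d x = d y ∨ d x = d z ∨ d y = d z)
    (x y z : ZMod (p * m)) (e : IsSolution (p * m) a₁ a₂ a₃ b x y z) :
    productColoring t c d x = productColoring t c d y ∨
      productColoring t c d x = productColoring t c d z ∨
      productColoring t c d y = productColoring t c d z := by
  have hp : p ≠ 0 := (Fact.out : p.Prime).ne_zero
  have : NeZero m := ⟨hm⟩
  have hX : ∀ x : ZMod (p * m), ((x.val : ℤ) : ZMod (p * m)) = x := by simp
  rw [← hX x, ← hX y, ← hX z, isSolution_intCast] at e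
  have hpdvd : (p : ℤ) ∣ ((p * m : ℕ) : ℤ) := by push_cast; exact dvd_mul_right _ _
  have ep : IsSolution p a₁ a₂ a₃ b ((x.val : ℤ) : ZMod p) (y.val : ℤ) (z.val : ℤ) :=
    isSolution_intCast.2 (hpdvd.trans e)
  have etp : IsSolution p a₁ a₂ a₃ b (t : ZMod p) t t :=
    isSolution_intCast.2 (hpdvd.trans (by
      rwa [show a₁ * t + a₂ * t + a₃ * t - b = (a₁ + a₂ + a₃) * t - b by ring]))
  have hcast : ∀ x : ZMod (p * m), (((x.val : ℤ)) : ZMod p) = ((x.val : ℕ) : ZMod p) := by simp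
  rw [hcast, hcast, hcast] at ep
  have main : c x.val = none → c y.val = none → c z.val = none →
      productColoring t c d x = productColoring t c d y ∨
      productColoring t c d x = productColoring t c d z ∨
      productColoring t c d y = productColoring t c d z := by
    intro hx hy hz
    rw [productColoring_of_none hx, productColoring_of_none hy, productColoring_of_none hz]
    have hq : ∀ {x : ZMod (p * m)}, c x.val = none → ∃ q : ℤ, (x.val : ℤ) = t + p * q := by
      intro x hx
      rw [hct, ← hcast, eq_comm, ZMod.intCast_eq_intCast_iff_dvd_sub] at hx
      obtain ⟨q, hq⟩ := hx
      exact ⟨q, by linear_combination hq⟩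
    obtain ⟨q₁, e₁⟩ := hq hx
    obtain ⟨q₂, e₂⟩ := hq hy
    obtain ⟨q₃, e₃⟩ := hq hz
    have hp' : (p : ℤ) ≠ 0 := by exact_mod_cast hp
    rw [e₁, e₂, e₃] at e ⊢
    simp only [add_sub_cancel_left, Int.mul_ediv_cancel_left _ hp', Sum.inr.injEq]
    refine hd _ _ _ (isSolution_intCast.2 ?_)
    have h : (p : ℤ) * m ∣ p * (a₁ * q₁ + a₂ * q₂ + a₃ * q₃) := by
      have := dvd_sub e ht
      rw [Nat.cast_mul] at this
      refine this.trans (dvd_of_eq ?_)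
      ring
    have h' := (mul_dvd_mul_iff_left hp').1 h
    have hmt := (show (m : ℤ) ∣ ((p * m : ℕ) : ℤ) by push_cast; exact dvd_mul_left _ _).trans ht
    refine (dvd_add h' hmt).trans (dvd_of_eq ?_)
    ring
  have same : ∀ {x y : ZMod (p * m)}, c x.val = c y.val → c x.val ≠ none →
      productColoring t c d x = productColoring t c d y := by
    intro x y hxy hx
    obtain ⟨i, hi⟩ := Option.ne_none_iff_exists'.1 hx
    rw [productColoring_of_some hi, productColoring_of_some (hxy.symm.trans hi)]
  unfold IsSolution at ep etp
  rcases hc _ _ _ ep with h | h | h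
  · by_cases hx : c x.val = none
    · have hy := h.symm.trans hx
      refine main hx hy ((hct _).2 ?_)
      rw [(hct _).1 hx, (hct _).1 hy] at ep
      exact mul_left_cancel₀ h₃ (by linear_combination ep - etp)
    · exact .inl (same h hx)
  · by_cases hx : c x.val = none
    · have hz := h.symm.trans hx
      refine main hx ((hct _).2 ?_) hz
      rw [(hct _).1 hx, (hct _).1 hz] at ep
      exact mul_left_cancel₀ h₂ (by linear_combination ep - etp)
    · exact .inr (.inl (same h hx))
  · by_cases hy : c y.val = none
    · have hz := h.symm.trans hy
      refine main ((hct _).2 ?_) hy hz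
      rw [(hct _).1 hy, (hct _).1 hz] at ep
      exact mul_left_cancel₀ h₁ (by linear_combination ep - etp)
    · exact .inr (.inr (same h hy))

end Product

theorem not_forcesRainbow_mul {p m r : ℕ} (hp : p.Prime) (hm : m ≠ 0)
    (hsum : IsUnit ((a₁ + a₂ + a₃ : ℤ) : ZMod (p * m)))
    (hprod : IsUnit ((a₁ * a₂ * a₃ : ℤ) : ZMod (p * m))) (h : ¬ ForcesRainbow m a₁ a₂ a₃ b r) :
    ¬ ForcesRainbow (p * m) a₁ a₂ a₃ b (rb p a₁ a₂ a₃ b - 2 + r) := by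
  have : Fact p.Prime := ⟨hp⟩
  have hp0 := hp.ne_zero
  have : NeZero (p * m) := ⟨mul_ne_zero hp0 hm⟩
  have hs := (isUnit_intCast_of_dvd (dvd_mul_right p m) hsum).ne_zero
  have hu := (isUnit_intCast_of_dvd (dvd_mul_right p m) hprod).ne_zero
  push_cast at hs hu
  simp only [ne_eq, mul_eq_zero, not_or] at hu
  obtain ⟨⟨h₁, h₂⟩, h₃⟩ := hu
  obtain ⟨T, hT⟩ := hsum.dvd (a := (b : ZMod (p * m)))
  have ht : ((p * m : ℕ) : ℤ) ∣ (a₁ + a₂ + a₃) * (T.val : ℤ) - b := by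
    rw [← ZMod.intCast_zmod_eq_zero_iff_dvd]
    push_cast at hT ⊢
    rw [hT]
    simp
  have htp : (a₁ + a₂ + a₃ : ZMod p) * ((T.val : ℤ) : ZMod p) = b := by
    have := (show (p : ℤ) ∣ ((p * m : ℕ) : ℤ) by push_cast; exact dvd_mul_right _ _).trans ht
    rw [← ZMod.intCast_zmod_eq_zero_iff_dvd, Int.cast_sub, sub_eq_zero] at this
    rw [← this]
    push_cast
    ring
  obtain ⟨d, hd, hdav⟩ := not_forcesRainbow_iff.1 h
  obtain ⟨c, hc, hct, hcav⟩ := exists_coloring_singleton h₁ h₂ h₃ hs htp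
  have := not_forcesRainbow_of_surjective _
    (productColoring_surjective hp0 hm hc hd ((hct _).2 rfl))
    (productColoring_avoids hm h₁ h₂ h₃ ht hct hcav hdav)
  simpa using this

theorem not_forcesRainbow_pow_mul {p m r : ℕ} (hp : p.Prime) (hm : m ≠ 0)
    (h : ¬ ForcesRainbow m a₁ a₂ a₃ b r) (j : ℕ)
    (hsum : IsUnit ((a₁ + a₂ + a₃ : ℤ) : ZMod (p ^ j * m)))
    (hprod : IsUnit ((a₁ * a₂ * a₃ : ℤ) : ZMod (p ^ j * m))) :
    ¬ ForcesRainbow (p ^ j * m) a₁ a₂ a₃ b (j * (rb p a₁ a₂ a₃ b - 2) + r) := by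
  induction j with
  | zero => simpa using h
  | succ j ih =>
    have hdvd : p ^ j * m ∣ p ^ (j + 1) * m := mul_dvd_mul_right (pow_dvd_pow p j.le_succ) m
    have := ih (isUnit_intCast_of_dvd hdvd hsum) (isUnit_intCast_of_dvd hdvd hprod)
    rw [show p ^ (j + 1) * m = p * (p ^ j * m) by ring] at hsum hprod ⊢
    rw [show ∀ k, (j + 1) * k + r = k + (j * k + r) from fun k => by ring]
    exact not_forcesRainbow_mul hp (mul_ne_zero (pow_ne_zero _ hp.ne_zero) hm) hsum hprod this

/-- The summand 1 is the only color of ℤ/1ℤ, the empty product. -/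
theorem not_forcesRainbow_prod {ι : Type*} (s : Finset ι) {p α : ι → ℕ} (hp : ∀ k, (p k).Prime)
    (hsum : IsUnit ((a₁ + a₂ + a₃ : ℤ) : ZMod (∏ k ∈ s, p k ^ α k)))
    (hprod : IsUnit ((a₁ * a₂ * a₃ : ℤ) : ZMod (∏ k ∈ s, p k ^ α k))) :
    ¬ ForcesRainbow (∏ k ∈ s, p k ^ α k) a₁ a₂ a₃ b
      (∑ k ∈ s, α k * (rb (p k) a₁ a₂ a₃ b - 2) + 1) := by
  classical
  induction s using Finset.induction with
  | empty => simpa using not_forcesRainbow_one _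
  | insert k s hk ih =>
    rw [prod_insert hk] at hsum hprod ⊢
    have hdvd := dvd_mul_left (∏ k ∈ s, p k ^ α k) (p k ^ α k)
    rw [sum_insert hk, add_assoc]
    exact not_forcesRainbow_pow_mul (hp k)
      (prod_ne_zero_iff.2 fun k _ => pow_ne_zero _ (hp k).ne_zero)
      (ih (isUnit_intCast_of_dvd hdvd hsum) (isUnit_intCast_of_dvd hdvd hprod)) _ hsum hprod

end RainbowFree

theorem mainTheorem7 (ℓ : ℕ) (p α : Fin ℓ → ℕ) (hp : ∀ k, (p k).Prime)
    (n : ℕ) (hn : n = ∏ k, p k ^ α k) (a₁ a₂ a₃ b : ℤ)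
    (hsum : IsUnit ((a₁ + a₂ + a₃ : ℤ) : ZMod n))
    (hprod : IsUnit ((a₁ * a₂ * a₃ : ℤ) : ZMod n)) :
    2 + ∑ k, (α k : ℤ) * ((rb (p k) a₁ a₂ a₃ b : ℤ) - 2) ≤ (rb n a₁ a₂ a₃ b : ℤ) := by
  subst hn
  have h := RainbowFree.lt_rb
    (Finset.prod_ne_zero_iff.2 fun k _ => pow_ne_zero _ (hp k).ne_zero)
    (RainbowFree.not_forcesRainbow_prod Finset.univ (b := b) hp hsum hprod)
  -- Truncated subtraction is harmless because rb ≥ 2.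
  have e : ∀ k, (α k : ℤ) * ((rb (p k) a₁ a₂ a₃ b : ℤ) - 2) =
      ((α k * (rb (p k) a₁ a₂ a₃ b - 2) : ℕ) : ℤ) := fun k => by
    rw [Nat.cast_mul, Nat.cast_sub (RainbowFree.two_le_rb (hp k).ne_zero), Nat.cast_ofNat]
  rw [Finset.sum_congr rfl fun k _ => e k, ← Nat.cast_sum]
  omega
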